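/- **Setting.** Let $\mathcal G=(V,E,c,\partial V)$ be a finite connected weighted graph without loops (parallel edges allowed), with positive edge weights $c$ and nonempty boundary $\partial V\subset V$; put $V^\circ=V\setminus\partial V$. For a set $A$ of edges let $\mathrm{weight}(A)=\prod_{e\in A}c(e)$. The random spanning tree is a spanning tree of the graph obtained from $\mathcal G$ by wiring $\partial V$ into one vertex (the sink), chosen with probability proportional to its weight. The Laplacian on functions on $V^\circ$, extended by $0$ to $\partial V$, is $\Delta f(v)=\sum_{v'\sim v}c(vv')(f(v)-f(v'))$ (one term for each edge at $v$). Let $G=\Delta^{-1}$, extended by $0$ to the boundary, and let $T(xy,uv)=c(uv)\,(G(x,u)-G(y,u)-G(x,v)+G(y,v))$ be the wired transfer current. For a set $\mathcal E$ of edges, $\det(I-T)_{\mathcal E}$ is the minor of $I-T$ with rows and columns indexed by $\mathcal E$, each edge occurring once, with an arbitrary fixed orientation. **Sandpile.** A configuration is a map $\eta:V^\circ\to\mathbb N$; it is stable if $\eta(x)<\deg x$ for all $x$, where $\deg x$ is the number of edges at $x$. A vertex $x$ with $\eta(x)\ge\deg x$ may topple, sending one particle along each of its edges; particles that reach $\partial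 V$ are lost. The recurrent configurations are the recurrent states of the Markov chain on stable configurations which adds a particle at a uniformly chosen vertex of $V^\circ$ and then stabilizes. Let $W\subset V^\circ$ be such that every vertex of $V\setminus W$ is joined to $\partial V$ by a path in $V\setminus W$. A map $\xi:W\to\mathbb N$ is a minimal subconfiguration if it is the restriction of a recurrent configuration, but is no longer so when any one of its heights is decreased. **Burning bijection.** Fix an ordering of the edges around each vertex of $V^\circ$. Given a recurrent $\eta$, burn $\partial V$ first; then at each step burn simultaneously all unburnt vertices $v\in V^\circ\setminus W$ such that $\eta(v)\ge u(v)$, where $u(v)$ is the number of edges from $v$ to unburnt vertices. When this stops, restart the fire from the set of all burnt vertices (regarded as burnt in one step), now allowing every vertex of $V^\circ$ to burn, with the same rule. A vertex $v$ that burns selects, among its edges to the vertices burnt exactly one step earlier, the edge preceded by exactly $\eta(v)-u(v)$ others of these edges in the ordering around $v$. Let $\varphi(\eta)$ be the set of selected edges. Then $\varphi$ is a bijection from the recurrent configurations to the spanning trees of $\mathcal G$ with $\partial V$ wired. Let $\mathbb P$ be the pullback under $\varphi$ of the law of the random spanning tree. **Proposition 4.3.** Let $\mathcal G_W$ be the graph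 obtained from $\mathcal G$ by wiring all vertices of $V\setminus W$ (including $\partial V$) into one vertex and removing loops; its edges are the edges of $\mathcal G$ with at least one end in $W$. For a spanning tree $\mathcal T$ of $\mathcal G_W$ let $\mathcal E(\mathcal T)$ be the set of edges of $\mathcal G$ with at least one end in $W$ that are not in $\mathcal T$. Then for every minimal subconfiguration $\xi$ on $W$ there is a spanning tree $\mathcal T_0$ of $\mathcal G_W$, given by the burning bijection in the sense that, for every recurrent $\eta$ with $\eta_W=\xi$, the edges of $\varphi(\eta)$ with at least one end in $W$ are exactly those of $\mathcal T_0$, such that $$\mathbb P(\eta_W=\xi)=\det(I-T)_{\mathcal E(\mathcal T_0)}=\sum_{\mathcal T}\frac{\mathrm{weight}(\mathcal T_0)}{\sum_{\mathcal T'}\mathrm{weight}(\mathcal T')}\,\det(I-T)_{\mathcal E(\mathcal T)},$$ where both sums are over the spanning trees of $\mathcal G_W$. -/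

import Mathlib

/-- A finite weighted graph with boundary `(V, E, c, ∂V)`. Parallel edges are allowed. Every edge
carries an (arbitrary) reference orientation from `src` to `tgt`. Loops are allowed in the
structure only because wiring vertices together creates some. -/
structure WeightedGraph (V E : Type*) where
  src : E → V
  tgt : E → V
  c : E → ℝ
  c_pos : ∀ e, 0 < c e
  bdry : Finset V

namespace WeightedGraph

noncomputable section

/-! ### Graphs, wiring, spanning trees -/

/-- The interior vertices `V° = V \ ∂V`. -/
abbrev Interior {V E : Type*} (G : WeightedGraph V E) : Type _ := {v : V // v ∉ G.bdry}

/-- The simple graph on `V` in which distinct `x`, `y` are adjacent when an edge of `A` joins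
them. -/
def simple {V E : Type*} (G : WeightedGraph V E) (A : Finset E) : SimpleGraph V where
  Adj x y := x ≠ y ∧ ∃ e ∈ A, s(G.src e, G.tgt e) = s(x, y)
  symm := ⟨fun _ _ h => ⟨h.1.symm, by
    obtain ⟨e, he, h'⟩ := h.2
    exact ⟨e, he, h'.trans Sym2.eq_swap⟩⟩⟩
  loopless := ⟨fun _ h => h.1 rfl⟩

/-- `G` is connected. -/
def IsConn {V E : Type*} [Fintype E] (G : WeightedGraph V E) : Prop :=
  (G.simple Finset.univ).Connected

/-- `(V, A)` is a spanning tree: it is connected and has no cycle, where a cycle of a multigraph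
is a loop, a pair of parallel edges, or a cycle of the underlying simple graph. -/
def IsSpanningTree {V E : Type*} (G : WeightedGraph V E) (A : Finset E) : Prop :=
  (∀ e ∈ A, G.src e ≠ G.tgt e) ∧
  (∀ e ∈ A, ∀ f ∈ A, s(G.src e, G.tgt e) = s(G.src f, G.tgt f) → e = f) ∧
  (G.simple A).IsTree

/-- The finite set of all spanning trees. -/
def spanningTrees {V E : Type*} [Fintype E] (G : WeightedGraph V E) : Finset (Finset E) :=
  open Classical in Finset.univ.filter fun A => G.IsSpanningTree A

/-- The weight of a set of edges: the product of the edge weights. -/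
def weight {V E : Type*} (G : WeightedGraph V E) (A : Finset E) : ℝ := ∏ e ∈ A, G.c e

/-- The weighted number of spanning trees. -/
def treeSum {V E : Type*} [Fintype E] (G : WeightedGraph V E) : ℝ :=
  ∑ A ∈ G.spanningTrees, G.weight A

/-- The graph obtained from `G` by wiring all vertices of the (nonempty) set `S` into one vertex
`none`. The edges are those of `G`; an edge inside `S` becomes a loop, which no spanning tree
contains, so that it does not matter for spanning trees whether these loops are removed. -/
def wire {V E : Type*} [DecidableEq V] (G : WeightedGraph V E) (S : Finset V) :
    WeightedGraph (Option {v : V // v ∉ S}) E where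
  src e := if h : G.src e ∈ S then none else some ⟨G.src e, h⟩
  tgt e := if h : G.tgt e ∈ S then none else some ⟨G.tgt e, h⟩
  c := G.c
  c_pos := G.c_pos
  bdry := {none}

/-- The graph with its whole boundary wired into one vertex (the sink). -/
abbrev wired {V E : Type*} [DecidableEq V] (G : WeightedGraph V E) :
    WeightedGraph (Option {v : V // v ∉ G.bdry}) E :=
  G.wire G.bdry

/-- The edges that join `v` to a vertex of `X`. -/
def edgesTo {V E : Type*} [Fintype E] [DecidableEq V] (G : WeightedGraph V E) (v : V)
    (X : Finset V) : Finset E :=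
  Finset.univ.filter fun e => (G.src e = v ∧ G.tgt e ∈ X) ∨ (G.tgt e = v ∧ G.src e ∈ X)

/-- The degree: the number of edges at `v`. -/
def deg {V E : Type*} [Fintype V] [Fintype E] [DecidableEq V] (G : WeightedGraph V E) (v : V) :
    ℕ :=
  (G.edgesTo v Finset.univ).card

/-! ### Laplacian, Green function, transfer current (wired boundary condition) -/

/-- The matrix of `Δ f (v) = ∑_{v' ∼ v} c(vv') (f(v) - f(v'))` on functions on the interior
vertices, extended by `0` to the boundary. -/
def laplacian {V E : Type*} [Fintype V] [Fintype E] [DecidableEq V] (G : WeightedGraph V E) :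
    Matrix G.Interior G.Interior ℝ :=
  Matrix.of fun u v =>
    if u = v then ∑ e ∈ G.edgesTo u Finset.univ, G.c e
    else - ∑ e ∈ G.edgesTo u {(v : V)}, G.c e

/-- The Dirichlet Green function `Δ⁻¹`, extended by `0` to the boundary. -/
def green {V E : Type*} [Fintype V] [Fintype E] [DecidableEq V] (G : WeightedGraph V E)
    (x y : V) : ℝ :=
  if h : x ∉ G.bdry ∧ y ∉ G.bdry then (G.laplacian)⁻¹ ⟨x, h.1⟩ ⟨y, h.2⟩ else 0

/-- The transfer current `T(xy, uv) = c(uv) (G(x,u) - G(y,u) - G(x,v) + G(y,v))`. -/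
def transferCurrent {V E : Type*} [Fintype V] [Fintype E] [DecidableEq V]
    (G : WeightedGraph V E) (e f : E) : ℝ :=
  G.c f * (G.green (G.src e) (G.src f) - G.green (G.tgt e) (G.src f)
    - G.green (G.src e) (G.tgt f) + G.green (G.tgt e) (G.tgt f))

/-- The minor `det (I - T)_F` with rows and columns indexed by the set `F` of edges. Each edge
occurs once, with its reference orientation. -/
def detCompl {V E : Type*} [Fintype V] [Fintype E] [DecidableEq V] [DecidableEq E]
    (G : WeightedGraph V E) (F : Finset E) : ℝ :=
  (Matrix.of fun e f : F => (1 : Matrix F F ℝ) e f - G.transferCurrent e f).det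

/-! ### The abelian sandpile -/

/-- Every height is less than the degree. -/
def Stable {V E : Type*} [Fintype V] [Fintype E] [DecidableEq V] (G : WeightedGraph V E)
    (η : G.Interior → ℕ) : Prop :=
  ∀ v : G.Interior, η v < G.deg v

/-- `η'` arises from `η` by toppling an unstable vertex `v`, which sends one particle along each
of its edges; particles that reach the boundary are lost. -/
def Topples {V E : Type*} [Fintype V] [Fintype E] [DecidableEq V] (G : WeightedGraph V E)
    (η η' : G.Interior → ℕ) : Prop :=
  ∃ v : G.Interior, G.deg v ≤ η v ∧
    η' = fun u : G.Interior => if u = v then η v - G.deg v else η u + (G.edgesTo v {(u : V)}).card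

/-- `η'` is the stabilization of `η`. -/
def StabilizesTo {V E : Type*} [Fintype V] [Fintype E] [DecidableEq V] (G : WeightedGraph V E)
    (η η' : G.Interior → ℕ) : Prop :=
  Relation.ReflTransGen G.Topples η η' ∧ G.Stable η'

/-- A transition of positive probability of the sandpile Markov chain: add a particle at some
interior vertex, then stabilize. -/
def Step {V E : Type*} [Fintype V] [Fintype E] [DecidableEq V] (G : WeightedGraph V E)
    (η η' : G.Interior → ℕ) : Prop :=
  ∃ v : G.Interior, G.StabilizesTo (η + Pi.single v 1) η'

/-- Recurrent states of the sandpile Markov chain, which is a chain on the finite set of stable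
configurations: the chain can return to `η` from every state that it can reach from `η`. -/
def Recurrent {V E : Type*} [Fintype V] [Fintype E] [DecidableEq V] (G : WeightedGraph V E)
    (η : G.Interior → ℕ) : Prop :=
  G.Stable η ∧
    ∀ η', Relation.ReflTransGen G.Step η η' → Relation.ReflTransGen G.Step η' η

/-- The finite set of recurrent configurations. -/
def recurrentConfigs {V E : Type*} [Fintype V] [Fintype E] [DecidableEq V]
    (G : WeightedGraph V E) : Finset (G.Interior → ℕ) :=
  open Classical in
    (Fintype.piFinset fun v : G.Interior => Finset.range (G.deg v)).filter fun η => G.Recurrent η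

/-- The configuration `η` restricts to `ξ` on `W`. -/
def RestrictsTo {V E : Type*} {G : WeightedGraph V E} (η : G.Interior → ℕ)
    {W : Finset G.Interior} (ξ : W → ℕ) : Prop :=
  ∀ w : W, η w = ξ w

/-- `ξ` is part of a recurrent configuration. -/
def Extendable {V E : Type*} [Fintype V] [Fintype E] [DecidableEq V] (G : WeightedGraph V E)
    {W : Finset G.Interior} (ξ : W → ℕ) : Prop :=
  ∃ η, G.Recurrent η ∧ RestrictsTo η ξ

/-- `ξ` is a minimal subconfiguration on `W`: it is part of a recurrent configuration, and this
fails as soon as one of its heights is decreased. -/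
def IsMinimal {V E : Type*} [Fintype V] [Fintype E] [DecidableEq V] (G : WeightedGraph V E)
    {W : Finset G.Interior} (ξ : W → ℕ) : Prop :=
  G.Extendable ξ ∧ ∀ w : W, ∀ k < ξ w, ¬ G.Extendable (Function.update ξ w k)

/-! ### The burning bijection in which `W` is burnt last -/

/-- Successive sets of burnt vertices. The fire starts with `burnt 0 = ∅`, `burnt 1 = X`; then, at
each step, all interior vertices of `A` burn whose height is at least the number of their edges
to unburnt vertices. -/
def burnt {V E : Type*} [Fintype V] [Fintype E] [DecidableEq V] (G : WeightedGraph V E)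
    (η : G.Interior → ℕ) (A X : Finset V) : ℕ → Finset V
  | 0 => ∅
  | 1 => X
  | k + 2 =>
    open Classical in
      G.burnt η A X (k + 1) ∪ Finset.univ.filter fun v =>
        v ∈ A ∧ ∃ h : v ∉ G.bdry, (G.edgesTo v (G.burnt η A X (k + 1))ᶜ).card ≤ η ⟨v, h⟩

/-- The vertices that are burnt eventually. -/
def allBurnt {V E : Type*} [Fintype V] [Fintype E] [DecidableEq V] (G : WeightedGraph V E)
    (η : G.Interior → ℕ) (A X : Finset V) : Finset V :=
  open Classical in Finset.univ.filter fun v => ∃ k, v ∈ G.burnt η A X k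

/-- The edges selected by a fire. A vertex `v` that burns at step `k + 2` selects one of its edges
to the vertices burnt exactly one step earlier. If `η v` is the number of edges of `v` to
vertices unburnt at that time plus `i`, it is the edge preceded by exactly `i` others of these
edges, in the ordering of the edges around `v` given by the numbering `rank v`. -/
def fireEdges {V E : Type*} [Fintype V] [Fintype E] [DecidableEq V] (G : WeightedGraph V E)
    (rank : G.Interior → E → ℕ) (η : G.Interior → ℕ) (A X : Finset V) : Finset E :=
  open Classical in Finset.univ.filter fun e =>
    ∃ (v : G.Interior) (k : ℕ),
      (v : V) ∈ G.burnt η A X (k + 2) \ G.burnt η A X (k + 1) ∧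
      e ∈ G.edgesTo v (G.burnt η A X (k + 1) \ G.burnt η A X k) ∧
      η v = (G.edgesTo v (G.burnt η A X (k + 1))ᶜ).card +
        ((G.edgesTo v (G.burnt η A X (k + 1) \ G.burnt η A X k)).filter
          fun f => rank v f < rank v e).card

/-- A set of interior vertices as a set of vertices. -/
def toVerts {V E : Type*} {G : WeightedGraph V E} (W : Finset G.Interior) : Finset V :=
  W.map (Function.Embedding.subtype _)

/-- The burning map relative to `W`. First the fire starts at the boundary and is only allowed to
burn vertices outside `W`; when it stops, it is started again from all vertices burnt so far, and
all vertices may burn. The image of `η` is the set of edges selected in the two phases. -/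
def burningMap {V E : Type*} [Fintype V] [Fintype E] [DecidableEq V] [DecidableEq E]
    (G : WeightedGraph V E) (rank : G.Interior → E → ℕ) (W : Finset G.Interior)
    (η : G.Interior → ℕ) : Finset E :=
  G.fireEdges rank η (toVerts W)ᶜ G.bdry ∪
    G.fireEdges rank η Finset.univ (G.allBurnt η (toVerts W)ᶜ G.bdry)

/-- The probability of `η_W = ξ` under the sandpile measure, the pullback under the burning
bijection of the weighted spanning tree measure on the wired graph. -/
def sandpileProb {V E : Type*} [Fintype V] [Fintype E] [DecidableEq V] [DecidableEq E]
    (G : WeightedGraph V E) (rank : G.Interior → E → ℕ) {W : Finset G.Interior}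
    (ξ : W → ℕ) : ℝ :=
  open Classical in
    ∑ η ∈ G.recurrentConfigs.filter (fun η => RestrictsTo η ξ),
      G.wired.weight (G.burningMap rank W η) / G.wired.treeSum

/-! ### The graph `G_W` -/

/-- The graph `G_W`: all vertices outside `W` are wired together. -/
abbrev wiredOff {V E : Type*} [Fintype V] [DecidableEq V] (G : WeightedGraph V E)
    (W : Finset G.Interior) : WeightedGraph (Option {v : V // v ∉ (toVerts W)ᶜ}) E :=
  G.wire (toVerts W)ᶜ

/-- The edges with at least one end in `W`; these are the edges of `G_W` which are not loops. -/
def edgesAt {V E : Type*} [Fintype E] [DecidableEq V] (G : WeightedGraph V E)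
    (W : Finset G.Interior) : Finset E :=
  Finset.univ.filter fun e => G.src e ∈ toVerts W ∨ G.tgt e ∈ toVerts W

end

end WeightedGraph

set_option linter.unusedSectionVars false

/-! ### Dhar's criterion for recurrence, and the abelian property. -/

namespace WeightedGraph

variable {V E : Type*} [Fintype V] [Fintype E] [DecidableEq V] (G : WeightedGraph V E)

/-! ### Edges between a vertex and a set -/

/-! The event that the heights on `W` equal a minimal `ξ` is turned into the event that the random
tree has prescribed edges at `W`, whose probability is a transfer current minor.

Recurrent configurations are the stable ones without forbidden subconfiguration
(`Recurrent.isAllowed`, `IsAllowed.recurrent`), which is exactly what makes the two-phase fire burn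
everything. The burning map is bijective (`bijOn_burningMap`) because the fire can be reconstructed
from the selected edges, and each height is then recovered from the position of its selected edge.

Minimality forces all of `V \ W` to burn in the first phase (`IsMinimal.allBurnt_eq`). Otherwise
some `v` outside `W` is ignited by some `w` in `W`. At the time `w` burns, `v` is still unburnt, so
`w` has a surplus as far as `W` alone is concerned. Its height can be lowered by one, with maximal
heights outside `W`. So the second phase starts from `V \ W` and depends on `ξ` only, and it selects
a fixed spanning tree `T₀` of `G_W`. Conversely, a recurrent configuration whose tree agrees with
`T₀` at `W` has heights `ξ` there (`eq_on_of_burningMap_inter_eq`).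

A wired tree has at least `|W|` edges at `W`, so it agrees with `T₀` there as soon as it avoids the
other edges at `W`. The matrix tree theorem with the weights on these edges set to zero expresses
this probability as a minor (`detCompl_mul_treeSum`). Finally, trees of `G_W` can be exchanged
inside a wired tree (`IsSpanningTree.exchange`), so the minor attached to `T` is proportional to the
weight of `T`. This gives the averaged formula. -/

theorem mem_edgesTo {v : V} {X : Finset V} {e : E} :
    e ∈ G.edgesTo v X ↔ (G.src e = v ∧ G.tgt e ∈ X) ∨ (G.tgt e = v ∧ G.src e ∈ X) := by
  simp [edgesTo]

theorem edgesTo_mono (v : V) {X Y : Finset V} (h : X ⊆ Y) : G.edgesTo v X ⊆ G.edgesTo v Y := by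
  intro e
  simp only [mem_edgesTo]
  rintro (⟨h1, h2⟩ | ⟨h1, h2⟩)
  · exact Or.inl ⟨h1, h h2⟩
  · exact Or.inr ⟨h1, h h2⟩

theorem card_edgesTo_mono (v : V) {X Y : Finset V} (h : X ⊆ Y) :
    (G.edgesTo v X).card ≤ (G.edgesTo v Y).card :=
  Finset.card_le_card (G.edgesTo_mono v h)

theorem card_edgesTo_le_deg (v : V) (X : Finset V) : (G.edgesTo v X).card ≤ G.deg v :=
  G.card_edgesTo_mono v (Finset.subset_univ X)

theorem edgesTo_singleton_comm (u v : V) : G.edgesTo u {v} = G.edgesTo v {u} := by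
  ext e
  simp only [mem_edgesTo, Finset.mem_singleton]
  tauto

theorem edgesTo_empty (v : V) : G.edgesTo v ∅ = ∅ := by
  ext e
  simp [mem_edgesTo]

variable {G}

theorem card_edgesTo_union (hloop : ∀ e, G.src e ≠ G.tgt e) (v : V) {X Y : Finset V}
    (h : Disjoint X Y) :
    (G.edgesTo v (X ∪ Y)).card = (G.edgesTo v X).card + (G.edgesTo v Y).card := by
  classical
  rw [← Finset.card_union_of_disjoint]
  · congr 1
    ext e
    simp only [mem_edgesTo, Finset.mem_union]
    tauto
  · rw [Finset.disjoint_left] at h ⊢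
    intro e
    simp only [mem_edgesTo]
    rintro (⟨h1, h2⟩ | ⟨h1, h2⟩) (⟨h3, h4⟩ | ⟨h3, h4⟩)
    · exact h h2 h4
    · exact hloop e (h1.trans h3.symm)
    · exact hloop e (h3.trans h1.symm)
    · exact h h2 h4

theorem card_edgesTo_add_compl (hloop : ∀ e, G.src e ≠ G.tgt e) (v : V) (X : Finset V) :
    (G.edgesTo v X).card + (G.edgesTo v Xᶜ).card = G.deg v := by
  rw [← card_edgesTo_union hloop v disjoint_compl_right, Finset.union_compl, deg]

theorem card_edgesTo_sdiff (hloop : ∀ e, G.src e ≠ G.tgt e) (v : V) {X Y : Finset V}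
    (h : X ⊆ Y) :
    (G.edgesTo v Yᶜ).card + (G.edgesTo v (Y \ X)).card = (G.edgesTo v Xᶜ).card := by
  rw [← card_edgesTo_union hloop v]
  · congr 2
    ext x
    have := @h x
    simp only [Finset.mem_union, Finset.mem_compl, Finset.mem_sdiff]
    tauto
  · rw [Finset.disjoint_left]
    intro x hx hx'
    simp only [Finset.mem_compl, Finset.mem_sdiff] at hx hx'
    exact hx hx'.1

theorem card_edgesTo_erase (hloop : ∀ e, G.src e ≠ G.tgt e) (u : V) {v : V} {F : Finset V}
    (h : v ∈ F) :
    (G.edgesTo u (F.erase v)).card + (G.edgesTo v {u}).card = (G.edgesTo u F).card := by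
  rw [edgesTo_singleton_comm, ← card_edgesTo_union hloop u, Finset.union_comm,
    ← Finset.insert_eq, Finset.insert_erase h]
  simp

theorem card_edgesTo_self (hloop : ∀ e, G.src e ≠ G.tgt e) (v : V) :
    (G.edgesTo v {v}).card = 0 := by
  rw [Finset.card_eq_zero, Finset.eq_empty_iff_forall_notMem]
  intro e
  simp only [mem_edgesTo, Finset.mem_singleton]
  rintro (⟨h1, h2⟩ | ⟨h1, h2⟩)
  · exact hloop e (h1.trans h2.symm)
  · exact hloop e (h2.trans h1.symm)

/-- A walk which leaves `F` has an edge leaving `F`. -/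
theorem exists_edgesTo_compl_of_walk {F : Finset V} {x b : V}
    (p : (G.simple Finset.univ).Walk x b) (hx : x ∈ F) (hb : b ∉ F) :
    ∃ v ∈ F, v ∈ p.support ∧ (G.edgesTo v Fᶜ).Nonempty := by
  obtain ⟨d, hd, h1, h2⟩ := p.exists_boundary_dart (F : Set V) hx hb
  obtain ⟨-, e, -, he⟩ := d.adj
  refine ⟨d.fst, h1, p.dart_fst_mem_support_of_mem_darts hd, e, ?_⟩
  rw [mem_edgesTo]
  simp only [Finset.mem_compl]
  rcases Sym2.eq_iff.1 he with ⟨h3, h4⟩ | ⟨h3, h4⟩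
  · exact Or.inl ⟨h3, h4 ▸ h2⟩
  · exact Or.inr ⟨h4, h3 ▸ h2⟩

theorem exists_edgesTo_compl (hconn : G.IsConn) (hbdry : G.bdry.Nonempty) {F : Finset V}
    (hF : F.Nonempty) (hd : Disjoint F G.bdry) : ∃ v ∈ F, (G.edgesTo v Fᶜ).Nonempty := by
  obtain ⟨x, hx⟩ := hF
  obtain ⟨b, hb⟩ := hbdry
  obtain ⟨p⟩ := hconn.preconnected x b
  obtain ⟨v, hv, -, h⟩ := exists_edgesTo_compl_of_walk p hx
    (fun h => Finset.disjoint_left.1 hd h hb)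
  exact ⟨v, hv, h⟩

theorem card_edgesTo_lt_deg (hloop : ∀ e, G.src e ≠ G.tgt e) {v : V} {F : Finset V}
    (h : (G.edgesTo v Fᶜ).Nonempty) : (G.edgesTo v F).card < G.deg v := by
  have := card_edgesTo_add_compl hloop v F
  have := h.card_pos
  omega

theorem deg_pos (hloop : ∀ e, G.src e ≠ G.tgt e) (hconn : G.IsConn) (hbdry : G.bdry.Nonempty)
    (v : G.Interior) : 0 < G.deg v := by
  obtain ⟨x, hx, h⟩ := exists_edgesTo_compl hconn hbdry (Finset.singleton_nonempty (v : V))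
    (Finset.disjoint_singleton_left.2 v.2)
  rw [Finset.mem_singleton] at hx
  subst hx
  exact lt_of_le_of_lt (Nat.zero_le _) (card_edgesTo_lt_deg hloop h)

/-! ### Allowed configurations -/

/-- `η` has no forbidden subconfiguration. -/
def IsAllowed (G : WeightedGraph V E) (η : G.Interior → ℕ) : Prop :=
  ∀ F : Finset V, F.Nonempty → Disjoint F G.bdry →
    ∃ v : G.Interior, (v : V) ∈ F ∧ (G.edgesTo v F).card ≤ η v

theorem IsAllowed.mono {η η' : G.Interior → ℕ} (h : G.IsAllowed η) (hle : η ≤ η') :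
    G.IsAllowed η' := fun F hF hd => by
  obtain ⟨v, hv, h1⟩ := h F hF hd
  exact ⟨v, hv, h1.trans (hle v)⟩

/-- If the toppled `v` lies in `F`, a witness for `F.erase v` gains exactly as many particles as it
has edges to `v`, so it is a witness for `F`. If `F = {v}`, there are no edges to count. If `v` is
outside `F`, heights on `F` only grow. -/
theorem IsAllowed.topples (hloop : ∀ e, G.src e ≠ G.tgt e) {η η' : G.Interior → ℕ}
    (h : G.IsAllowed η) (ht : G.Topples η η') : G.IsAllowed η' := by
  obtain ⟨v, hv, rfl⟩ := ht
  intro F hF hd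
  by_cases hvF : (v : V) ∈ F
  · rcases (F.erase (v : V)).eq_empty_or_nonempty with h0 | h0
    · refine ⟨v, hvF, ?_⟩
      have : F = {(v : V)} := by
        rw [← Finset.insert_erase hvF, h0, insert_empty_eq]
      rw [this, card_edgesTo_self hloop]
      exact Nat.zero_le _
    · obtain ⟨u, hu, h1⟩ := h _ h0 (hd.mono_left (Finset.erase_subset _ _))
      have hne : u ≠ v := fun h => (Finset.mem_erase.1 hu).1 (congrArg _ h)
      refine ⟨u, Finset.mem_of_mem_erase hu, ?_⟩
      rw [← card_edgesTo_erase hloop _ hvF]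
      simp only [hne, if_false]
      omega
  · obtain ⟨u, hu, h1⟩ := h F hF hd
    have hne : u ≠ v := fun h => hvF (h ▸ hu)
    refine ⟨u, hu, h1.trans ?_⟩
    simp [hne]

theorem IsAllowed.step (hloop : ∀ e, G.src e ≠ G.tgt e) {η η' : G.Interior → ℕ}
    (h : G.IsAllowed η) (hs : G.Step η η') : G.IsAllowed η' := by
  obtain ⟨v, hv, -⟩ := hs
  have h0 : G.IsAllowed (η + Pi.single v 1) := h.mono (by simp)
  induction hv with
  | refl => exact h0
  | tail _ h2 ih => exact ih.topples hloop h2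

/-- The largest stable configuration is allowed. -/
theorem isAllowed_deg_sub_one (hloop : ∀ e, G.src e ≠ G.tgt e) (hconn : G.IsConn)
    (hbdry : G.bdry.Nonempty) : G.IsAllowed fun v => G.deg v - 1 := fun F hF hd => by
  obtain ⟨v, hv, h⟩ := exists_edgesTo_compl hconn hbdry hF hd
  have := card_edgesTo_lt_deg hloop h
  exact ⟨⟨v, Finset.disjoint_left.1 hd hv⟩, hv, by dsimp only; omega⟩

/-! ### The abelian property -/

/-- `η'` is reached from `η` by `n` topplings. -/
def TopplesIn (G : WeightedGraph V E) : ℕ → (G.Interior → ℕ) → (G.Interior → ℕ) → Prop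
  | 0, η, η' => η = η'
  | n + 1, η, η' => ∃ ζ, G.Topples η ζ ∧ TopplesIn G n ζ η'

theorem exists_topplesIn {η η' : G.Interior → ℕ} (h : Relation.ReflTransGen G.Topples η η') :
    ∃ n, G.TopplesIn n η η' := by
  induction h using Relation.ReflTransGen.head_induction_on with
  | refl => exact ⟨0, rfl⟩
  | head h1 _ ih =>
    obtain ⟨n, hn⟩ := ih
    exact ⟨n + 1, _, h1, hn⟩

theorem TopplesIn.reflTransGen {n : ℕ} {η η' : G.Interior → ℕ} (h : G.TopplesIn n η η') :
    Relation.ReflTransGen G.Topples η η' := by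
  induction n generalizing η with
  | zero => exact h ▸ Relation.ReflTransGen.refl
  | succ n ih =>
    obtain ⟨ζ, h1, h2⟩ := h
    exact Relation.ReflTransGen.head h1 (ih h2)

theorem Stable.not_topples {η η' : G.Interior → ℕ} (h : G.Stable η) : ¬ G.Topples η η' := by
  rintro ⟨v, hv, -⟩
  exact absurd (h v) (not_lt.2 hv)

theorem exists_topples_of_not_stable {η : G.Interior → ℕ} (h : ¬ G.Stable η) :
    ∃ η', G.Topples η η' := by
  simp only [Stable, not_forall, not_lt] at h
  obtain ⟨v, hv⟩ := h
  exact ⟨_, v, hv, rfl⟩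

/-- Toppling one vertex only adds particles to another, so two distinct unstable vertices can topple
in either order with the same result. -/
theorem Topples.diamond {η η₁ η₂ : G.Interior → ℕ} (h1 : G.Topples η η₁) (h2 : G.Topples η η₂) :
    η₁ = η₂ ∨ ∃ ζ, G.Topples η₁ ζ ∧ G.Topples η₂ ζ := by
  obtain ⟨v, hv, rfl⟩ := h1
  obtain ⟨w, hw, rfl⟩ := h2
  by_cases hvw : v = w
  · exact Or.inl (by subst hvw; rfl)
  · right
    refine ⟨_, ⟨w, ?_, rfl⟩, ⟨v, ?_, ?_⟩⟩
    · simp only [Ne.symm hvw, if_false]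
      omega
    · simp only [hvw, if_false]
      omega
    · funext u
      by_cases h1 : u = v
      · subst h1
        simp only [hvw, if_true, if_false]
        omega
      · by_cases h2 : u = w
        · subst h2
          simp only [h1, if_true, if_false]
          omega
        · simp only [h1, h2, if_false]
          omega

theorem Topples.add_right {η η' : G.Interior → ℕ} (h : G.Topples η η') (ζ : G.Interior → ℕ) :
    G.Topples (η + ζ) (η' + ζ) := by
  obtain ⟨v, hv, rfl⟩ := h
  refine ⟨v, hv.trans (by simp), ?_⟩
  funext u
  by_cases h : u = v
  · subst h
    simp only [Pi.add_apply, if_true]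
    omega
  · simp only [Pi.add_apply, h, if_false]
    omega

theorem reflTransGen_topples_add_right {η η' : G.Interior → ℕ}
    (h : Relation.ReflTransGen G.Topples η η') (ζ : G.Interior → ℕ) :
    Relation.ReflTransGen G.Topples (η + ζ) (η' + ζ) :=
  h.lift (· + ζ) fun _ _ h => h.add_right ζ

/-- If some sequence of topplings stabilizes `η`, then every sequence of topplings can be
continued to a sequence of the same length with the same result. -/
theorem TopplesIn.of_topples {n : ℕ} {η η' ζ : G.Interior → ℕ} (hs : G.Stable ζ)
    (h : G.TopplesIn (n + 1) η ζ) (ht : G.Topples η η') : G.TopplesIn n η' ζ := by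
  induction n generalizing η η' with
  | zero =>
    obtain ⟨η₁, h1, rfl⟩ := h
    rcases h1.diamond ht with h2 | ⟨_, h2, -⟩
    · exact h2.symm
    · exact absurd h2 hs.not_topples
  | succ n ih =>
    obtain ⟨η₁, h1, h2⟩ := h
    rcases h1.diamond ht with rfl | ⟨ζ', h3, h4⟩
    · exact h2
    · exact ⟨ζ', h4, ih h2 h3⟩

theorem reflTransGen_of_reflTransGen {η η' ζ : G.Interior → ℕ} (hs : G.Stable ζ)
    (h : Relation.ReflTransGen G.Topples η ζ) (h' : Relation.ReflTransGen G.Topples η η') :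
    Relation.ReflTransGen G.Topples η' ζ := by
  induction h' with
  | refl => exact h
  | tail _ h2 ih =>
    obtain ⟨n, hn⟩ := exists_topplesIn ih
    cases n with
    | zero =>
      obtain rfl : _ = ζ := hn
      exact absurd h2 hs.not_topples
    | succ n => exact (hn.of_topples hs h2).reflTransGen

/-- A toppling legal for `η` is legal for `η + β` and shortens the given stabilizing sequence by
one. Hence stabilizing `η` first, with `β` kept aside, terminates. -/
theorem TopplesIn.exists_stable {n : ℕ} {η ζ β : G.Interior → ℕ} (hs : G.Stable ζ)
    (h : G.TopplesIn n (η + β) ζ) :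
    ∃ η', G.StabilizesTo η η' ∧ Relation.ReflTransGen G.Topples (η' + β) ζ := by
  induction n generalizing η with
  | zero =>
    by_cases hη : G.Stable η
    · exact ⟨η, ⟨.refl, hη⟩, h.reflTransGen⟩
    · obtain ⟨η', h'⟩ := exists_topples_of_not_stable hη
      obtain rfl : η + β = ζ := h
      exact absurd (h'.add_right β) hs.not_topples
  | succ n ih =>
    by_cases hη : G.Stable η
    · exact ⟨η, ⟨.refl, hη⟩, h.reflTransGen⟩
    · obtain ⟨η₁, h1⟩ := exists_topples_of_not_stable hη
      obtain ⟨η', h2, h3⟩ := ih (h.of_topples hs (h1.add_right β))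
      exact ⟨η', ⟨.head h1 h2.1, h2.2⟩, h3⟩

/-- Adding the particles of `β` all at once can be replaced by transitions of the chain. -/
theorem reflTransGen_step {η β ζ : G.Interior → ℕ} (hη : G.Stable η) (hs : G.Stable ζ)
    (h : Relation.ReflTransGen G.Topples (η + β) ζ) : Relation.ReflTransGen G.Step η ζ := by
  induction hn : ∑ v, β v generalizing η β with
  | zero =>
    have hβ : β = 0 := by
      funext v
      simpa using (Finset.sum_eq_zero_iff.1 hn) v
    rw [hβ, add_zero] at h
    rcases h.cases_head with rfl | ⟨_, h1, -⟩
    · exact .refl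
    · exact absurd h1 hη.not_topples
  | succ n ih =>
    have : ∃ v, β v ≠ 0 := by
      by_contra! h0
      simp [h0] at hn
    obtain ⟨v, hv⟩ := this
    have hle : Pi.single v 1 ≤ β := by
      intro u
      by_cases hu : u = v
      · subst hu
        simp
        omega
      · simp [hu]
    obtain ⟨β', rfl⟩ := exists_add_of_le hle
    rw [← add_assoc] at h
    obtain ⟨m, hm⟩ := exists_topplesIn h
    obtain ⟨η', h1, h2⟩ := hm.exists_stable hs
    refine .head ⟨v, h1⟩ (ih h1.2 h2 ?_)
    simp only [Pi.add_apply, Finset.sum_add_distrib, Finset.sum_pi_single', Finset.mem_univ,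
      if_true] at hn
    omega

theorem reflTransGen_step_deg_sub_one {η : G.Interior → ℕ} (hη : G.Stable η)
    (hdeg : ∀ v : G.Interior, 0 < G.deg v) :
    Relation.ReflTransGen G.Step η fun v : G.Interior => G.deg v - 1 := by
  have hle : η ≤ fun v : G.Interior => G.deg v - 1 := fun v => by
    have := hη v
    dsimp only
    omega
  obtain ⟨β, hβ⟩ := exists_add_of_le hle
  refine reflTransGen_step hη (β := β) (fun v => ?_) (hβ ▸ .refl)
  have := hdeg v
  omega

/-! ### Recurrent configurations are the stable allowed ones -/

/-- The chain returns to `η` from the largest stable configuration, which is allowed, and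
transitions preserve allowedness. -/
theorem Recurrent.isAllowed (hloop : ∀ e, G.src e ≠ G.tgt e) (hconn : G.IsConn)
    (hbdry : G.bdry.Nonempty) {η : G.Interior → ℕ} (h : G.Recurrent η) : G.IsAllowed η := by
  have h1 := h.2 _ (reflTransGen_step_deg_sub_one h.1 (deg_pos hloop hconn hbdry))
  clear h
  induction h1 with
  | refl => exact isAllowed_deg_sub_one hloop hconn hbdry
  | tail _ h2 ih => exact ih.step hloop h2

/-- Toppling every vertex once, in the order in which the vertices burn. -/
theorem IsAllowed.reflTransGen_of_burnt (hloop : ∀ e, G.src e ≠ G.tgt e) {η : G.Interior → ℕ}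
    (h : G.IsAllowed η) (B : Finset V) (hB : G.bdry ⊆ B)
    (hle : ∀ v : G.Interior, (v : V) ∈ B → (G.edgesTo v Bᶜ).card ≤ η v) :
    Relation.ReflTransGen G.Topples
      (fun v => if (v : V) ∈ B then η v - (G.edgesTo v Bᶜ).card
        else η v + (G.edgesTo v B).card) η := by
  induction hn : Bᶜ.card generalizing B with
  | zero =>
    have : B = Finset.univ := by simpa using hn
    subst this
    simp only [Finset.mem_univ, if_true, Finset.compl_univ, edgesTo_empty, Finset.card_empty,
      Nat.sub_zero]
    exact .refl
  | succ n ih =>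
    -- `B` is the boundary together with the vertices already toppled. A vertex of `Bᶜ` that
    -- violates forbiddenness reaches its degree once its edges to `B` have delivered their
    -- particles. The hypothesis `hle` keeps the truncated subtraction exact.
    obtain ⟨v, hv, h1⟩ := h Bᶜ (Finset.card_pos.1 (by omega))
      (disjoint_compl_left.mono_right hB)
    have hvB : (v : V) ∉ B := Finset.mem_compl.1 hv
    have key : ∀ u : V, (G.edgesTo u (insert (v : V) B)ᶜ).card + (G.edgesTo v {u}).card =
        (G.edgesTo u Bᶜ).card := fun u => by
      rw [Finset.compl_insert, card_edgesTo_erase hloop u hv]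
    have key' : ∀ u : V, (G.edgesTo u (insert (v : V) B)).card =
        (G.edgesTo u B).card + (G.edgesTo v {u}).card := fun u => by
      rw [Finset.insert_eq, card_edgesTo_union hloop u (Finset.disjoint_singleton_left.2 hvB),
        edgesTo_singleton_comm, add_comm]
    have hadd := card_edgesTo_add_compl hloop (v : V) B
    have hself := card_edgesTo_self hloop (v : V)
    refine .head ⟨v, ?_, rfl⟩ ?_
    · simp only [hvB, if_false]
      omega
    · convert ih (insert (v : V) B) (hB.trans (Finset.subset_insert _ _)) ?_ ?_ using 1
      · funext u
        have hk := key u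
        have hk' := key' u
        by_cases huv : u = v
        · subst huv
          simp only [hvB, if_true, if_false, Finset.mem_insert, true_or]
          omega
        · have : (u : V) ≠ v := fun h => huv (Subtype.ext h)
          by_cases huB : (u : V) ∈ B
          · have := hle u huB
            simp only [huv, huB, if_true, if_false, Finset.mem_insert, or_true]
            omega
          · simp only [huv, huB, this, if_false, Finset.mem_insert, or_self]
            omega
      · intro u hu
        have hk := key u
        rcases Finset.mem_insert.1 hu with h2 | h2
        · obtain rfl := Subtype.ext h2
          omega
        · have := hle u h2
          omega
      · rw [Finset.compl_insert, Finset.card_erase_of_mem hv, hn]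
        rfl

/-- Letting the boundary fire once, along all its edges, is undone by toppling every interior vertex
once. This is repeated `k` times. -/
theorem IsAllowed.reflTransGen_add_nsmul (hloop : ∀ e, G.src e ≠ G.tgt e) {η : G.Interior → ℕ}
    (h : G.IsAllowed η) (k : ℕ) :
    Relation.ReflTransGen G.Topples
      (η + k • fun v : G.Interior => (G.edgesTo v G.bdry).card) η := by
  induction k with
  | zero => simpa using Relation.ReflTransGen.refl
  | succ k ih =>
    refine Relation.ReflTransGen.trans ?_ ih
    rw [succ_nsmul', ← add_assoc]
    refine reflTransGen_topples_add_right ?_ _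
    convert h.reflTransGen_of_burnt hloop G.bdry subset_rfl (fun v hv => absurd hv v.2) using 1
    funext v
    simp [v.2]

theorem exists_topple_many {ζ : G.Interior → ℕ} (v : G.Interior) (m : ℕ)
    (h : m * G.deg v ≤ ζ v) :
    ∃ ζ', Relation.ReflTransGen G.Topples ζ ζ' ∧ ζ' v + m * G.deg v = ζ v ∧
      ∀ u, u ≠ v → ζ' u = ζ u + m * (G.edgesTo v {(u : V)}).card := by
  induction m with
  | zero => exact ⟨ζ, .refl, by simp, by simp⟩
  | succ m ih =>
    rw [Nat.succ_mul] at h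
    obtain ⟨ζ', h1, h2, h3⟩ := ih (by omega)
    refine ⟨_, h1.tail ⟨v, by omega, rfl⟩, ?_, fun u hu => ?_⟩
    · rw [Nat.succ_mul]
      simp only [if_true]
      omega
    · rw [Nat.succ_mul]
      simp only [hu, if_false, h3 u hu]
      omega

/-- Particles fired from the boundary can be piled up anywhere. By connectedness some new vertex is
adjacent to the boundary, which can fire more often, or to a vertex of `S`, which can be made high
enough to topple many times. -/
theorem exists_large_on (hconn : G.IsConn) (hbdry : G.bdry.Nonempty) (η : G.Interior → ℕ) (n : ℕ) :
    ∃ S : Finset V, (Finset.univ \ (G.bdry ∪ S)).card ≤ Fintype.card V - n ∧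
      ∀ M : ℕ, ∃ (k : ℕ) (ζ : G.Interior → ℕ), Relation.ReflTransGen G.Topples
        (η + k • fun v : G.Interior => (G.edgesTo v G.bdry).card) ζ ∧
        ∀ v : G.Interior, (v : V) ∈ S → M ≤ ζ v := by
  induction n with
  | zero =>
    refine ⟨∅, ?_, fun M => ⟨0, _, .refl, by simp⟩⟩
    exact (Finset.card_le_univ _).trans (by simp)
  | succ n ih =>
    obtain ⟨S, hS, hM⟩ := ih
    rcases (Finset.univ \ (G.bdry ∪ S)).eq_empty_or_nonempty with h0 | h0
    · exact ⟨S, by simp [h0], hM⟩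
    have hd : Disjoint (Finset.univ \ (G.bdry ∪ S)) G.bdry :=
      Finset.sdiff_disjoint.mono_right Finset.subset_union_left
    obtain ⟨v, hv, e, he⟩ := exists_edgesTo_compl hconn hbdry h0 hd
    refine ⟨insert v S, ?_, fun M => ?_⟩
    · have : Finset.univ \ (G.bdry ∪ insert v S) = (Finset.univ \ (G.bdry ∪ S)).erase v := by
        ext x
        simp only [Finset.mem_sdiff, Finset.mem_univ, true_and, Finset.mem_union,
          Finset.mem_insert, Finset.mem_erase]
        tauto
      rw [this, Finset.card_erase_of_mem hv]
      omega
    have hvb : v ∉ G.bdry := Finset.disjoint_left.1 hd hv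
    have hcase : (∃ s ∈ G.bdry, e ∈ G.edgesTo v {s}) ∨
        ∃ s : G.Interior, (s : V) ∈ S ∧ (s : V) ≠ v ∧ e ∈ G.edgesTo v {(s : V)} := by
      have : ∃ s, s ∈ G.bdry ∪ S ∧ e ∈ G.edgesTo v {s} := by
        simp only [mem_edgesTo, Finset.mem_compl, Finset.mem_sdiff, Finset.mem_univ, true_and,
          not_not, Finset.mem_singleton] at he ⊢
        rcases he with ⟨h1, h2⟩ | ⟨h1, h2⟩
        · exact ⟨_, h2, Or.inl ⟨h1, rfl⟩⟩
        · exact ⟨_, h2, Or.inr ⟨h1, rfl⟩⟩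
      obtain ⟨s, hs, hes⟩ := this
      by_cases hsb : s ∈ G.bdry
      · exact Or.inl ⟨s, hsb, hes⟩
      · have hsS := (Finset.mem_union.1 hs).resolve_left hsb
        refine Or.inr ⟨⟨s, hsb⟩, hsS, ?_, hes⟩
        rintro rfl
        exact (Finset.mem_sdiff.1 hv).2 (Finset.mem_union_right _ hsS)
    rcases hcase with ⟨s, hs, hes⟩ | ⟨s, hs, hsv, hes⟩
    · obtain ⟨k, ζ, h1, h2⟩ := hM M
      refine ⟨k + M, ζ + M • fun v : G.Interior => (G.edgesTo v G.bdry).card, ?_, ?_⟩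
      · rw [add_nsmul, ← add_assoc]
        exact reflTransGen_topples_add_right h1 _
      · intro u hu
        rcases Finset.mem_insert.1 hu with h3 | h3
        · have : 1 ≤ (G.edgesTo u G.bdry).card := Finset.card_pos.2
            ⟨e, G.edgesTo_mono _ (Finset.singleton_subset_iff.2 hs) (h3 ▸ hes)⟩
          simp only [Pi.add_apply, Pi.smul_apply, smul_eq_mul]
          nlinarith
        · exact (h2 u h3).trans (by simp)
    -- Enough for `s` to topple `M` times, each time feeding the new vertex, and still keep `M`
    -- particles.
    · obtain ⟨k, ζ, h1, h2⟩ := hM (M + M * G.deg s)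
      obtain ⟨ζ', h3, h4, h5⟩ := exists_topple_many s M (ζ := ζ) (by have := h2 s hs; omega)
      refine ⟨k, ζ', h1.trans h3, fun u hu => ?_⟩
      by_cases hus : u = s
      · subst hus
        have := h2 u hs
        omega
      rw [h5 u hus]
      rcases Finset.mem_insert.1 hu with h6 | h6
      · have : 1 ≤ (G.edgesTo s {(u : V)}).card := Finset.card_pos.2
          ⟨e, by rw [edgesTo_singleton_comm, h6]; exact hes⟩
        nlinarith
      · have := h2 u h6
        nlinarith [Nat.zero_le (M * G.deg s), Nat.zero_le (M * (G.edgesTo s {(u : V)}).card)]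

/-- Every reachable state leads to the largest stable configuration. Firing the boundary often
enough onto `η` leads to some `ζ` above that configuration. By the abelian property `ζ` still
stabilizes to `η`, so adding the difference closes the loop. -/
theorem IsAllowed.recurrent (hloop : ∀ e, G.src e ≠ G.tgt e) (hconn : G.IsConn)
    (hbdry : G.bdry.Nonempty) {η : G.Interior → ℕ} (h : G.IsAllowed η) (hs : G.Stable η) :
    G.Recurrent η := by
  refine ⟨hs, fun η' h' => ?_⟩
  have hst : G.Stable η' := by
    rcases h'.cases_tail with rfl | ⟨_, -, v, h1⟩
    · exact hs
    · exact h1.2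
  refine (reflTransGen_step_deg_sub_one hst (deg_pos hloop hconn hbdry)).trans ?_
  obtain ⟨S, hS, hM⟩ := exists_large_on hconn hbdry η (Fintype.card V)
  obtain ⟨k, ζ, h1, h2⟩ := hM (∑ v : V, G.deg v)
  have h3 : (fun v : G.Interior => G.deg v - 1) ≤ ζ := fun v => by
    have hv : (v : V) ∈ S := by
      by_contra hv
      have : (v : V) ∈ Finset.univ \ (G.bdry ∪ S) := by simp [hv, v.2]
      have := Finset.card_pos.2 ⟨_, this⟩
      omega
    have h4 := h2 v hv
    have h5 := Finset.single_le_sum (f := fun v => G.deg v) (fun _ _ => Nat.zero_le _)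
      (Finset.mem_univ (v : V))
    dsimp only at h5 ⊢
    omega
  obtain ⟨β, hβ⟩ := exists_add_of_le h3
  refine reflTransGen_step (β := β) (fun v => ?_) hs ?_
  · have := deg_pos hloop hconn hbdry v
    omega
  · rw [← hβ]
    exact reflTransGen_of_reflTransGen hs (h.reflTransGen_add_nsmul hloop k) h1

end WeightedGraph

namespace WeightedGraph

variable {V E : Type*} [Fintype V] [Fintype E] [DecidableEq V] [DecidableEq E]
  {G : WeightedGraph V E}

/-! ### Spanning trees as parent maps -/

/-- `f` selects for each vertex outside `S` an edge to a parent of smaller height. -/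
def IsParentMap (G : WeightedGraph V E) (S : Finset V) (f : {v // v ∉ S} → E) : Prop :=
  ∃ h : V → ℕ, ∀ v, ∃ u, s(G.src (f v), G.tgt (f v)) = s((v : V), u) ∧ h u < h v

/-- An edge selected from both of its ends would have to descend in both directions. -/
theorem IsParentMap.injective {S : Finset V} {f : {v // v ∉ S} → E} (hf : G.IsParentMap S f) :
    Function.Injective f := by
  obtain ⟨h, hf⟩ := hf
  intro v v' hv
  obtain ⟨u, h1, h2⟩ := hf v
  obtain ⟨u', h3, h4⟩ := hf v'
  rw [hv, h3] at h1
  rcases Sym2.eq_iff.1 h1 with ⟨h5, -⟩ | ⟨h5, h6⟩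
  · exact Subtype.ext h5.symm
  · rw [h5, h6] at h4
    exact absurd h4 h2.asymm

theorem IsParentMap.card_image {S : Finset V} {f : {v // v ∉ S} → E} (hf : G.IsParentMap S f) :
    (Finset.univ.image f).card = Fintype.card {v // v ∉ S} := by
  rw [Finset.card_image_of_injective _ hf.injective, Finset.card_univ]

/-- Induction on the height for `f`. Write `f v = g u`; if `u ≠ v`, then `u` is the `f`-parent of
`v`, so `f u = g u = f v` by induction, contradicting injectivity. -/
theorem IsParentMap.eq_of_image_subset {S : Finset V} {f g : {v // v ∉ S} → E}
    (hf : G.IsParentMap S f) (hg : G.IsParentMap S g)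
    (hfg : Finset.univ.image f ⊆ Finset.univ.image g) : f = g := by
  have hinj := hf.injective
  obtain ⟨h, hf⟩ := hf
  obtain ⟨h', hg⟩ := hg
  have key : ∀ n (v : {v // v ∉ S}), h v = n → f v = g v := by
    intro n
    induction n using Nat.strong_induction_on with
    | _ n ih =>
      intro v hn
      obtain ⟨u, -, hu⟩ := Finset.mem_image.1 (hfg (Finset.mem_image_of_mem f (Finset.mem_univ v)))
      obtain ⟨a, h1, h2⟩ := hf v
      obtain ⟨b, h3, h4⟩ := hg u
      rw [← hu, h3] at h1
      rcases Sym2.eq_iff.1 h1 with ⟨h5, -⟩ | ⟨h5, h6⟩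
      · rw [← hu, Subtype.ext h5]
      · have := ih (h u) (by rw [h5, ← hn]; exact h2) u rfl
        rw [hu] at this
        rw [← hu, hinj this]
  exact funext fun v => key _ v rfl

/-- The vertex of `G.wire S` to which `v` belongs. -/
def toWire (S : Finset V) (v : V) : Option {v // v ∉ S} :=
  if h : v ∈ S then none else some ⟨v, h⟩

theorem toWire_eq_some {S : Finset V} {v : V} {w : {v // v ∉ S}} :
    toWire S v = some w ↔ v = w := by
  unfold toWire
  split_ifs with h
  · simp only [false_iff]
    rintro rfl
    exact w.2 h
  · simp [Subtype.ext_iff]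

theorem toWire_coe {S : Finset V} (v : {v // v ∉ S}) : toWire S (v : V) = some v :=
  toWire_eq_some.2 rfl

theorem wire_ends (S : Finset V) (e : E) :
    s((G.wire S).src e, (G.wire S).tgt e) = s(toWire S (G.src e), toWire S (G.tgt e)) := rfl

theorem wire_ends_of_eq {S : Finset V} {e : E} {x y : V} (h : s(G.src e, G.tgt e) = s(x, y)) :
    s((G.wire S).src e, (G.wire S).tgt e) = s(toWire S x, toWire S y) := by
  rw [wire_ends, ← Sym2.map_mk, h, Sym2.map_mk]

/-- Descending along parents reaches the sink, so the graph is connected, and it has at most one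
edge per vertex other than the sink. A connected graph with so few edges is a tree. -/
theorem IsParentMap.isSpanningTree {S : Finset V} {f : {v // v ∉ S} → E}
    (hf : G.IsParentMap S f) : (G.wire S).IsSpanningTree (Finset.univ.image f) := by
  have hcard := hf.card_image
  obtain ⟨h, hf⟩ := hf
  choose u hu hlt using hf
  have hends : ∀ v, s((G.wire S).src (f v), (G.wire S).tgt (f v)) = s(some v, toWire S (u v)) :=
    fun v => by rw [wire_ends_of_eq (hu v), toWire_coe]
  have hne : ∀ v, some v ≠ toWire S (u v) := fun v h => by
    have := toWire_eq_some.1 h.symm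
    exact (hlt v).ne (by rw [this])
  have hconn : ((G.wire S).simple (Finset.univ.image f)).Connected := by
    rw [SimpleGraph.connected_iff_exists_forall_reachable]
    refine ⟨none, fun x => ?_⟩
    have key : ∀ n (v : {v // v ∉ S}), h v = n →
        ((G.wire S).simple (Finset.univ.image f)).Reachable none (some v) := by
      intro n
      induction n using Nat.strong_induction_on with
      | _ n ih =>
        intro v hn
        have hadj : ((G.wire S).simple (Finset.univ.image f)).Adj (toWire S (u v)) (some v) :=
          ⟨(hne v).symm, f v, Finset.mem_image_of_mem f (Finset.mem_univ v),
            (hends v).trans Sym2.eq_swap⟩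
        refine SimpleGraph.Reachable.trans ?_ hadj.reachable
        by_cases hS : u v ∈ S
        · simp [toWire, hS]
        · simp only [toWire, hS, dite_false]
          exact ih _ (hn ▸ hlt v) ⟨u v, hS⟩ rfl
    cases x with
    | none => exact SimpleGraph.Reachable.refl _
    | some v => exact key _ v rfl
  refine ⟨?_, ?_, ?_⟩
  · intro e he heq
    obtain ⟨v, -, rfl⟩ := Finset.mem_image.1 he
    have := hends v
    rw [heq] at this
    rcases Sym2.eq_iff.1 this with ⟨h1, h2⟩ | ⟨h1, h2⟩
    · exact hne v (h1.symm.trans h2)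
    · exact hne v (h2.symm.trans h1)
  · intro e he e' he' heq
    obtain ⟨v, -, rfl⟩ := Finset.mem_image.1 he
    obtain ⟨v', -, rfl⟩ := Finset.mem_image.1 he'
    rw [hends, hends] at heq
    rcases Sym2.eq_iff.1 heq with ⟨h1, -⟩ | ⟨h1, h2⟩
    · rw [Option.some.inj h1]
    · have h3 := toWire_eq_some.1 h1.symm
      have h4 := toWire_eq_some.1 h2
      have h5 := hlt v
      have h6 := hlt v'
      rw [h3] at h6
      rw [h4] at h5
      exact absurd h5 h6.asymm
  · rw [SimpleGraph.isTree_iff_connected_and_card]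
    refine ⟨hconn, le_antisymm ?_ ?_⟩
    · rw [Nat.card_eq_fintype_card (α := Option _), Fintype.card_option, ← hcard]
      refine Nat.add_le_add_right ?_ 1
      rw [Nat.card_coe_set_eq]
      refine (Set.ncard_le_ncard (t := (Finset.univ.image f).image
        fun e => s((G.wire S).src e, (G.wire S).tgt e)) ?_ (Finset.finite_toSet _)).trans ?_
      · intro z
        refine Sym2.ind (fun x y hxy => ?_) z
        obtain ⟨-, e, he, h1⟩ := hxy
        rw [← h1]
        exact Finset.mem_coe.2 (Finset.mem_image_of_mem (fun e => s((G.wire S).src e, (G.wire S).tgt e)) he)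
      · rw [Set.ncard_coe_finset]
        exact Finset.card_image_le
    · exact hconn.card_vert_le_card_edgeSet_add_one

/-- Each vertex selects the first edge of a shortest path to the sink, with the distance as height.
Counting edges shows that nothing of `A` is left over. -/
theorem IsSpanningTree.exists_parentMap {S : Finset V} {A : Finset E}
    (hA : (G.wire S).IsSpanningTree A) :
    ∃ f, G.IsParentMap S f ∧ Finset.univ.image f = A := by
  obtain ⟨hl, hpar, ht⟩ := hA
  have h1 : ∀ v : {v // v ∉ S}, ∃ e ∈ A, ∃ u, s(G.src e, G.tgt e) = s((v : V), u) ∧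
      ((G.wire S).simple A).dist (toWire S u) none <
        ((G.wire S).simple A).dist (toWire S v) none := by
    intro v
    obtain ⟨p, hp⟩ := (ht.connected.preconnected (some v) none).exists_walk_length_eq_dist
    obtain ⟨x, hadj, q, rfl⟩ := SimpleGraph.Walk.exists_eq_cons_of_ne (by simp) p
    rw [SimpleGraph.Walk.length_cons] at hp
    obtain ⟨-, e, he, h2⟩ := hadj
    have hd := SimpleGraph.dist_le q
    refine ⟨e, he, ?_⟩
    rw [toWire_coe]
    rw [wire_ends] at h2
    rcases Sym2.eq_iff.1 h2 with ⟨h3, h4⟩ | ⟨h3, h4⟩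
    · exact ⟨G.tgt e, by rw [toWire_eq_some.1 h3], by rw [h4]; omega⟩
    · exact ⟨G.src e, by rw [toWire_eq_some.1 h4, Sym2.eq_swap], by rw [h3]; omega⟩
  choose f hf u hu using h1
  have hpm : G.IsParentMap S f := ⟨fun v => ((G.wire S).simple A).dist (toWire S v) none,
    fun v => ⟨u v, hu v⟩⟩
  refine ⟨f, hpm, Finset.eq_of_subset_of_card_le ?_ ?_⟩
  · intro e he
    obtain ⟨v, -, rfl⟩ := Finset.mem_image.1 he
    exact hf v
  · rw [hpm.card_image]
    have h2 := (SimpleGraph.isTree_iff_connected_and_card.1 ht).2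
    rw [Nat.card_eq_fintype_card (α := Option _), Fintype.card_option] at h2
    rw [← Nat.add_right_cancel h2, Nat.card_coe_set_eq, ← Set.ncard_coe_finset]
    refine Set.ncard_le_ncard_of_injOn (fun e => s((G.wire S).src e, (G.wire S).tgt e)) ?_ ?_
      (Set.toFinite _)
    · intro e he
      exact ⟨hl e he, e, he, rfl⟩
    · intro e he e' he' heq
      exact hpar e he e' he' heq

theorem IsSpanningTree.card_eq {S : Finset V} {A : Finset E}
    (hA : (G.wire S).IsSpanningTree A) : A.card = Fintype.card {v // v ∉ S} := by
  obtain ⟨f, hf, rfl⟩ := hA.exists_parentMap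
  exact hf.card_image

theorem IsSpanningTree.eq_of_subset {S : Finset V} {A B : Finset E}
    (hA : (G.wire S).IsSpanningTree A) (hB : (G.wire S).IsSpanningTree B) (h : A ⊆ B) : A = B :=
  Finset.eq_of_subset_of_card_le h (by rw [hA.card_eq, hB.card_eq])

end WeightedGraph

/-! ### Matrix tree theorem and transfer current theorem. -/

namespace WeightedGraph

noncomputable section

variable {V E : Type*} [Fintype V] [Fintype E] [DecidableEq V] [DecidableEq E]
  {G : WeightedGraph V E}

/-! ### The weighted matrix tree theorem -/

/-- The signed incidence matrix, restricted to the interior vertices. -/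
def incidence (G : WeightedGraph V E) : Matrix G.Interior E ℝ :=
  Matrix.of fun v e => (if G.src e = v then 1 else 0) - (if G.tgt e = v then 1 else 0)

theorem sum_ite_interior (x : V) (X : V → ℝ) (hX : ∀ v ∈ G.bdry, X v = 0) :
    ∑ v : G.Interior, (if x = v then 1 else 0) * X v = X x := by
  by_cases hx : x ∈ G.bdry
  · rw [hX x hx]
    refine Finset.sum_eq_zero fun v _ => ?_
    rw [if_neg (fun h : x = v => v.2 (h ▸ hx)), zero_mul]
  · rw [Finset.sum_eq_single ⟨x, hx⟩]
    · simp
    · intro v _ hv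
      rw [if_neg (fun h => hv (Subtype.ext h.symm)), zero_mul]
    · exact fun h => absurd (Finset.mem_univ _) h

theorem sum_incidence_mul (e : E) (X : V → ℝ) (hX : ∀ v ∈ G.bdry, X v = 0) :
    ∑ v : G.Interior, G.incidence v e * X v = X (G.src e) - X (G.tgt e) := by
  rw [← sum_ite_interior (G.src e) X hX, ← sum_ite_interior (G.tgt e) X hX,
    ← Finset.sum_sub_distrib]
  simp only [incidence, Matrix.of_apply, sub_mul]

/-- Each row is a sum over edges, so multilinearity expands the determinant over choices of one edge
per interior vertex. Only parent maps will contribute. -/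
theorem det_incidence_mul_diagonal (c : E → ℝ) :
    (G.incidence * Matrix.diagonal c * G.incidence.transpose).det =
      ∑ f : G.Interior → E, (∏ v, c (f v)) * ((∏ v, G.incidence v (f v)) *
        (Matrix.of fun v u => G.incidence u (f v)).det) := by
  have h1 : G.incidence * Matrix.diagonal c * G.incidence.transpose =
      fun v => ∑ e, (c e * G.incidence v e) • fun u => G.incidence u e := by
    funext v u
    rw [Matrix.mul_apply, Finset.sum_apply]
    refine Finset.sum_congr rfl fun e _ => ?_
    rw [Matrix.mul_diagonal, Matrix.transpose_apply, Pi.smul_apply, smul_eq_mul]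
    ring
  rw [h1]
  change Matrix.detRowAlternating.toMultilinearMap _ = _
  rw [MultilinearMap.map_sum]
  refine Finset.sum_congr rfl fun f _ => ?_
  rw [MultilinearMap.map_smul_univ, Finset.prod_mul_distrib, smul_eq_mul, mul_assoc]
  rfl

theorem incidence_eq_zero {v : G.Interior} {e : E} (h : (v : V) ∉ s(G.src e, G.tgt e)) :
    G.incidence v e = 0 := by
  rw [Sym2.mem_iff, not_or] at h
  simp [incidence, Ne.symm h.1, Ne.symm h.2]

/-- The heights make the matrix triangular, so its determinant is the product of its diagonal
entries, which are `±1` and occur squared. -/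
theorem IsParentMap.prod_mul_det {f : G.Interior → E} (hf : G.IsParentMap G.bdry f) :
    (∏ v, G.incidence v (f v)) * (Matrix.of fun v u => G.incidence u (f v)).det = 1 := by
  obtain ⟨h, hf⟩ := hf
  have hle : ∀ u v, G.incidence u (f v) ≠ 0 → u = v ∨ h u < h v := by
    intro u v huv
    obtain ⟨w, h1, h2⟩ := hf v
    have h3 : (u : V) ∈ s(G.src (f v), G.tgt (f v)) := by
      by_contra h4
      exact huv (incidence_eq_zero h4)
    rw [h1, Sym2.mem_iff] at h3
    rcases h3 with h3 | h3
    · exact Or.inl (Subtype.ext h3)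
    · exact Or.inr (h3 ▸ h2)
  have hdet : (Matrix.of fun v u => G.incidence u (f v)).det = ∏ v, G.incidence v (f v) := by
    rw [Matrix.det_apply, Finset.sum_eq_single 1]
    · simp
    · intro σ _ hσ
      have : ∃ v, G.incidence v (f (σ v)) = 0 := by
        by_contra! h0
        have h1 : ∀ v, v = σ v ∨ h v < h (σ v) := fun v => hle _ _ (h0 v)
        have h2 : ∀ v : G.Interior, h v ≤ h (σ v) := fun v => by
          rcases h1 v with h3 | h3
          · rw [← h3]
          · exact h3.le
        -- A contributing permutation never lowers the height but preserves the total height, so it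
        -- preserves each height and is the identity.
        have h3 : ∑ v : G.Interior, h v = ∑ v, h (σ v) :=
          (Equiv.sum_comp σ fun v : G.Interior => h v).symm
        rw [Finset.sum_eq_sum_iff_of_le fun v _ => h2 v] at h3
        refine hσ (Equiv.ext fun v => ?_)
        have h4 := h3 v (Finset.mem_univ v)
        rcases h1 v with h5 | h5
        · exact h5.symm
        · omega
      obtain ⟨v, hv⟩ := this
      rw [Finset.prod_eq_zero (Finset.mem_univ v) (by simpa using hv), smul_zero]
    · exact fun h => absurd (Finset.mem_univ _) h
  rw [hdet, ← Finset.prod_mul_distrib]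
  refine Finset.prod_eq_one fun v _ => ?_
  obtain ⟨w, h1, h2⟩ := hf v
  have hne : w ≠ v := fun h => h2.ne (by rw [h])
  rcases Sym2.eq_iff.1 h1 with ⟨h3, h4⟩ | ⟨h3, h4⟩ <;> simp [incidence, h3, h4, hne]

/-- If every selected edge touches its vertex, iterating the other end either always reaches the
boundary, and then the number of steps is a height, or it fails to do so from some vertex. The
indicator of such vertices is then a nonzero kernel vector. -/
theorem prod_mul_det_eq_zero {f : G.Interior → E} (hf : ¬ G.IsParentMap G.bdry f) :
    (∏ v, G.incidence v (f v)) * (Matrix.of fun v u => G.incidence u (f v)).det = 0 := by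
  by_cases h0 : ∃ v, G.incidence v (f v) = 0
  · obtain ⟨v, hv⟩ := h0
    rw [Finset.prod_eq_zero (Finset.mem_univ v) hv, zero_mul]
  push Not at h0
  have hp : ∀ v : G.Interior, ∃ u, s(G.src (f v), G.tgt (f v)) = s((v : V), u) := by
    intro v
    have h3 : (v : V) ∈ s(G.src (f v), G.tgt (f v)) := by
      by_contra h4
      exact h0 v (incidence_eq_zero h4)
    obtain ⟨u, hu⟩ := h3
    exact ⟨u, hu⟩
  choose p hp using hp
  set P : V → V := fun v => if h : v ∈ G.bdry then v else p ⟨v, h⟩ with hP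
  have hPv : ∀ v : G.Interior, P v = p v := fun v => by simp [hP, v.2]
  have hreach : ∀ v : G.Interior, (∃ n, P^[n] v ∈ G.bdry) ↔ ∃ n, P^[n] (p v) ∈ G.bdry := by
    intro v
    constructor
    · rintro ⟨n, hn⟩
      cases n with
      | zero => exact absurd hn v.2
      | succ n => exact ⟨n, by rwa [Function.iterate_succ_apply, hPv] at hn⟩
    · rintro ⟨n, hn⟩
      exact ⟨n + 1, by rwa [Function.iterate_succ_apply, hPv]⟩
  classical
  by_cases hall : ∀ v, ∃ n, P^[n] v ∈ G.bdry
  · refine absurd ⟨fun v => Nat.find (hall v), fun v => ⟨p v, hp v, ?_⟩⟩ hf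
    have h1 := Nat.find_spec (hall v)
    cases hn : Nat.find (hall v) with
    | zero =>
      rw [hn] at h1
      exact absurd h1 v.2
    | succ n =>
      rw [hn, Function.iterate_succ_apply, hPv] at h1
      change Nat.find (hall (p v)) < Nat.find (hall v)
      rw [hn]
      exact Nat.lt_succ_of_le (Nat.find_min' (hall (p v)) h1)
  push Not at hall
  obtain ⟨v₀, hv₀⟩ := hall
  refine mul_eq_zero_of_right _ (Matrix.exists_mulVec_eq_zero_iff.1 ?_)
  set X : V → ℝ := fun v => if ∃ n, P^[n] v ∈ G.bdry then 0 else 1 with hX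
  refine ⟨fun v => X v, fun h => ?_, ?_⟩
  · have := congrFun h ⟨v₀, hv₀ 0⟩
    simp [hX, hv₀] at this
  · funext v
    have h1 := sum_incidence_mul (G := G) (f v) X (fun v hv => if_pos ⟨0, hv⟩)
    have h2 : X v = X (p v) := by
      simp only [hX, hreach v]
    change ∑ u, G.incidence u (f v) * X u = 0
    rw [h1]
    rcases Sym2.eq_iff.1 (hp v) with ⟨h3, h4⟩ | ⟨h3, h4⟩ <;> rw [h3, h4, h2, sub_self]

theorem mem_spanningTrees {V' : Type*} {G : WeightedGraph V' E} {A : Finset E} :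
    A ∈ G.spanningTrees ↔ G.IsSpanningTree A := by
  simp [spanningTrees]

/-- The matrix tree theorem, with arbitrary weights. -/
theorem det_eq_sum_spanningTrees (c : E → ℝ) :
    (G.incidence * Matrix.diagonal c * G.incidence.transpose).det =
      ∑ A ∈ G.wired.spanningTrees, ∏ e ∈ A, c e := by
  classical
  rw [det_incidence_mul_diagonal]
  rw [← Finset.sum_filter_of_ne (p := fun f => G.IsParentMap G.bdry f)]
  · refine Finset.sum_bij (fun f _ => Finset.univ.image f) ?_ ?_ ?_ ?_
    · intro f hf
      exact mem_spanningTrees.2 (Finset.mem_filter.1 hf).2.isSpanningTree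
    · intro f hf g hg hfg
      exact (Finset.mem_filter.1 hf).2.eq_of_image_subset (Finset.mem_filter.1 hg).2 hfg.subset
    · intro A hA
      obtain ⟨f, hf, rfl⟩ := (mem_spanningTrees.1 hA).exists_parentMap
      exact ⟨f, Finset.mem_filter.2 ⟨Finset.mem_univ f, hf⟩, rfl⟩
    · intro f hf
      have hf := (Finset.mem_filter.1 hf).2
      rw [hf.prod_mul_det, mul_one, Finset.prod_image fun x _ y _ h => hf.injective h]
  · intro f _ h
    by_contra hf
    exact h (by rw [prod_mul_det_eq_zero hf, mul_zero])

theorem laplacian_eq (hloop : ∀ e, G.src e ≠ G.tgt e) :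
    G.laplacian = G.incidence * Matrix.diagonal G.c * G.incidence.transpose := by
  ext u v
  rw [Matrix.mul_apply]
  simp only [Matrix.mul_diagonal, Matrix.transpose_apply, laplacian, Matrix.of_apply, edgesTo,
    Finset.sum_filter, ← Finset.sum_neg_distrib, incidence]
  split_ifs with huv
  · subst huv
    refine Finset.sum_congr rfl fun e _ => ?_
    have := hloop e
    by_cases h1 : G.src e = u
    · have h2 : G.tgt e ≠ u := fun h => this (h1.trans h.symm)
      simp [h1, h2]
    · by_cases h2 : G.tgt e = u <;> simp [h1, h2]
  · refine Finset.sum_congr rfl fun e _ => ?_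
    have huv' : (u : V) ≠ v := fun h => huv (Subtype.ext h)
    have := hloop e
    by_cases h1 : G.src e = u
    · have h2 : G.tgt e ≠ u := fun h => this (h1.trans h.symm)
      by_cases h3 : G.tgt e = v <;> simp [h1, h2, h3, huv', Ne.symm huv']
    · by_cases h2 : G.tgt e = u
      · by_cases h3 : G.src e = v <;> simp [h1, h2, h3, huv', Ne.symm huv']
      · simp [h1, h2]

theorem det_laplacian (hloop : ∀ e, G.src e ≠ G.tgt e) :
    G.laplacian.det = G.wired.treeSum := by
  rw [laplacian_eq hloop, det_eq_sum_spanningTrees]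
  rfl

theorem weight_pos {V' : Type*} (G : WeightedGraph V' E) (A : Finset E) : 0 < G.weight A :=
  Finset.prod_pos fun e _ => G.c_pos e

theorem treeSum_pos {V' : Type*} {G : WeightedGraph V' E} {A : Finset E}
    (hA : G.IsSpanningTree A) : 0 < G.treeSum :=
  Finset.sum_pos (fun A _ => G.weight_pos A) ⟨A, mem_spanningTrees.2 hA⟩

/-- Matrix form of `T`, with the Green function between two incidence matrices, prepared for
exchanging the factors in `det (1 - M N)`. -/
theorem transferCurrent_eq (e f : E) :
    G.transferCurrent e f = ∑ u, G.incidence u e *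
      ∑ w, G.laplacian⁻¹ u w * (G.incidence w f * G.c f) := by
  have hg : ∀ (u w : G.Interior), G.green u w = G.laplacian⁻¹ u w := fun u w => by
    simp only [green, dif_pos (And.intro u.2 w.2)]
  have hl : ∀ x, ∀ y ∈ G.bdry, G.green x y = 0 := fun x y hy => by
    simp [green, hy]
  have hr : ∀ x ∈ G.bdry, ∀ y, G.green x y = 0 := fun x hx y => by
    simp [green, hx]
  have h1 : ∀ u : G.Interior, ∑ w, G.laplacian⁻¹ u w * (G.incidence w f * G.c f) =
      G.c f * (G.green u (G.src f) - G.green u (G.tgt f)) := fun u => by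
    rw [← sum_incidence_mul f (G.green u) (hl u), Finset.mul_sum]
    refine Finset.sum_congr rfl fun w _ => ?_
    rw [hg]
    ring
  simp only [h1]
  rw [sum_incidence_mul e (fun u => G.c f * (G.green u (G.src f) - G.green u (G.tgt f)))
    (fun x hx => by simp [hr x hx]), transferCurrent]
  ring

/-- The transfer current theorem: the minor of `I - T` is the probability that the random
spanning tree contains none of the given edges. -/
theorem detCompl_mul_treeSum (hloop : ∀ e, G.src e ≠ G.tgt e) (h0 : G.wired.treeSum ≠ 0)
    (F : Finset E) :
    G.detCompl F * G.wired.treeSum =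
      ∑ A ∈ G.wired.spanningTrees with Disjoint A F, G.weight A := by
  set BF : Matrix G.Interior F ℝ := G.incidence.submatrix id (fun e : F => (e : E)) with hBF
  set K : Matrix G.Interior F ℝ := Matrix.of fun w f => G.incidence w f * G.c f with hK
  have hunit : IsUnit G.laplacian.det := by
    rw [det_laplacian hloop]
    exact isUnit_iff_ne_zero.2 h0
  have h1 : G.detCompl F = (1 - BF.transpose * (G.laplacian⁻¹ * K)).det := by
    unfold detCompl
    congr 1
    ext e f
    rw [Matrix.of_apply, Matrix.sub_apply, transferCurrent_eq, Matrix.mul_apply]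
    simp only [Matrix.mul_apply, hBF, hK, Matrix.transpose_apply, Matrix.submatrix_apply, id,
      Matrix.of_apply]
  -- This is the Laplacian with the edges of `F` deleted. Its determinant sums over the trees that
  -- avoid `F`.
  have h2 : G.laplacian * (1 - G.laplacian⁻¹ * K * BF.transpose) =
      G.incidence * Matrix.diagonal (fun e => if e ∈ F then 0 else G.c e) *
        G.incidence.transpose := by
    rw [Matrix.mul_sub, Matrix.mul_one, ← Matrix.mul_assoc, ← Matrix.mul_assoc,
      Matrix.mul_nonsing_inv _ hunit, Matrix.one_mul, laplacian_eq hloop]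
    ext u w
    rw [Matrix.sub_apply, Matrix.mul_apply, Matrix.mul_apply, Matrix.mul_apply, sub_eq_iff_eq_add]
    simp only [Matrix.mul_diagonal, Matrix.transpose_apply, hBF, hK, Matrix.of_apply,
      Matrix.submatrix_apply, id]
    rw [Finset.sum_coe_sort F (fun e => G.incidence u e * G.c e * G.incidence w e),
      ← Finset.sum_filter_add_sum_filter_not Finset.univ (· ∈ F), add_comm,
      ← Finset.sum_filter_add_sum_filter_not Finset.univ (· ∈ F) (f := fun e =>
        G.incidence u e * (if e ∈ F then 0 else G.c e) * G.incidence w e)]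
    have h3 : ∑ e ∈ Finset.univ.filter (· ∈ F),
        G.incidence u e * (if e ∈ F then 0 else G.c e) * G.incidence w e = 0 :=
      Finset.sum_eq_zero fun e he => by simp [(Finset.mem_filter.1 he).2]
    rw [h3, zero_add]
    congr 1
    · refine Finset.sum_congr rfl fun e he => ?_
      rw [if_neg (Finset.mem_filter.1 he).2]
    · rw [Finset.filter_mem_eq_inter, Finset.univ_inter]
  rw [h1, Matrix.det_one_sub_mul_comm, ← det_laplacian hloop, mul_comm, ← Matrix.det_mul, h2,
    det_eq_sum_spanningTrees, Finset.sum_filter]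
  refine Finset.sum_congr rfl fun A _ => ?_
  split_ifs with hA
  · refine Finset.prod_congr rfl fun e he => ?_
    rw [if_neg (Finset.disjoint_left.1 hA he)]
  · rw [Finset.not_disjoint_iff] at hA
    obtain ⟨e, he, heF⟩ := hA
    exact Finset.prod_eq_zero he (if_pos heF)

end

end WeightedGraph

namespace WeightedGraph

noncomputable section

variable {V E : Type*} [Fintype V] [Fintype E] [DecidableEq V] [DecidableEq E]
  {G : WeightedGraph V E}

/-! ### Spanning trees of `G` and of `G_W` -/

theorem notMem_bdry_of_mem_toVerts {W : Finset G.Interior} {v : V} (h : v ∈ toVerts W) :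
    v ∉ G.bdry := by
  obtain ⟨w, -, rfl⟩ := Finset.mem_map.1 h
  exact w.2

theorem coe_mem_toVerts {W : Finset G.Interior} {v : G.Interior} :
    (v : V) ∈ toVerts W ↔ v ∈ W := by
  refine ⟨fun h => ?_, fun h => Finset.mem_map_of_mem _ h⟩
  obtain ⟨w, hw, h⟩ := Finset.mem_map.1 h
  exact Subtype.ext h ▸ hw

theorem mem_edgesAt {W : Finset G.Interior} {e : E} :
    e ∈ G.edgesAt W ↔ G.src e ∈ toVerts W ∨ G.tgt e ∈ toVerts W := by
  simp [edgesAt]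

theorem mem_edgesAt_of_eq {W : Finset G.Interior} {e : E} {x y : V}
    (h : s(G.src e, G.tgt e) = s(x, y)) :
    e ∈ G.edgesAt W ↔ x ∈ toVerts W ∨ y ∈ toVerts W := by
  rw [mem_edgesAt]
  rcases Sym2.eq_iff.1 h with ⟨h1, h2⟩ | ⟨h1, h2⟩
  · rw [h1, h2]
  · rw [h1, h2, or_comm]

theorem mem_toVerts_of_notMem_compl {W : Finset G.Interior} {v : V} (h : v ∉ (toVerts W)ᶜ) :
    v ∈ toVerts W := by
  simpa using h

/-- The restriction of a parent map to `W`. -/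
def restrictParent (W : Finset G.Interior) (f : G.Interior → E)
    (w : {v // v ∉ (toVerts W)ᶜ}) : E :=
  f ⟨w, notMem_bdry_of_mem_toVerts (mem_toVerts_of_notMem_compl w.2)⟩

theorem IsParentMap.restrictParent {f : G.Interior → E} (hf : G.IsParentMap G.bdry f)
    (W : Finset G.Interior) : G.IsParentMap (toVerts W)ᶜ (restrictParent W f) := by
  obtain ⟨h, hf⟩ := hf
  exact ⟨h, fun w => hf _⟩

theorem IsParentMap.mem_edgesAt {W : Finset G.Interior}
    {g : {v // v ∉ (toVerts W)ᶜ} → E} (hg : G.IsParentMap (toVerts W)ᶜ g)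
    (w : {v // v ∉ (toVerts W)ᶜ}) : g w ∈ G.edgesAt W := by
  obtain ⟨h, hg⟩ := hg
  obtain ⟨u, hu, -⟩ := hg w
  exact (mem_edgesAt_of_eq hu).2 (Or.inl (mem_toVerts_of_notMem_compl w.2))

theorem IsParentMap.image_restrictParent_subset {f : G.Interior → E}
    (hf : G.IsParentMap G.bdry f) (W : Finset G.Interior) :
    Finset.univ.image (WeightedGraph.restrictParent W f) ⊆
      Finset.univ.image f ∩ G.edgesAt W := by
  intro e he
  obtain ⟨w, -, rfl⟩ := Finset.mem_image.1 he
  exact Finset.mem_inter.2 ⟨Finset.mem_image_of_mem f (Finset.mem_univ _),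
    (hf.restrictParent W).mem_edgesAt w⟩

/-- By the hypothesis only vertices of `W` select edges at `W`, so these edges form the image of the
restricted parent map. -/
theorem IsParentMap.isSpanningTree_inter {f : G.Interior → E} (hf : G.IsParentMap G.bdry f)
    {W : Finset G.Interior} (h : ∀ v, v ∉ W → f v ∉ G.edgesAt W) :
    (G.wiredOff W).IsSpanningTree (Finset.univ.image f ∩ G.edgesAt W) := by
  have h1 := (hf.restrictParent W).isSpanningTree
  have h2 : Finset.univ.image (WeightedGraph.restrictParent W f) =
      Finset.univ.image f ∩ G.edgesAt W := by
    refine Finset.Subset.antisymm (hf.image_restrictParent_subset W) fun e he => ?_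
    obtain ⟨he, heW⟩ := Finset.mem_inter.1 he
    obtain ⟨v, -, rfl⟩ := Finset.mem_image.1 he
    have hv : v ∈ W := by
      by_contra hv
      exact h v hv heW
    exact Finset.mem_image.2 ⟨⟨v, by simpa using coe_mem_toVerts.2 hv⟩, Finset.mem_univ _, rfl⟩
  rwa [h2] at h1

/-- The vertices of `W` already select `|W|` edges at `W`, as many as a tree of `G_W` has. By
injectivity no other vertex can select one of them. -/
theorem IsParentMap.notMem_edgesAt {f : G.Interior → E} (hf : G.IsParentMap G.bdry f)
    {W : Finset G.Interior}
    (h : (G.wiredOff W).IsSpanningTree (Finset.univ.image f ∩ G.edgesAt W)) (v : G.Interior)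
    (hv : v ∉ W) : f v ∉ G.edgesAt W := by
  intro hfv
  have h1 := Finset.eq_of_subset_of_card_le (hf.image_restrictParent_subset W)
    (by rw [h.card_eq, (hf.restrictParent W).card_image])
  have h2 : f v ∈ Finset.univ.image (WeightedGraph.restrictParent W f) := by
    rw [h1]
    exact Finset.mem_inter.2 ⟨Finset.mem_image_of_mem f (Finset.mem_univ v), hfv⟩
  obtain ⟨w, -, hw⟩ := Finset.mem_image.1 h2
  have := hf.injective hw
  exact hv (coe_mem_toVerts.1 (this ▸ mem_toVerts_of_notMem_compl w.2))

theorem IsSpanningTree.subset_edgesAt {W : Finset G.Interior} {T : Finset E}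
    (hT : (G.wiredOff W).IsSpanningTree T) : T ⊆ G.edgesAt W := by
  obtain ⟨g, hg, rfl⟩ := hT.exists_parentMap
  intro e he
  obtain ⟨w, -, rfl⟩ := Finset.mem_image.1 he
  exact hg.mem_edgesAt w

/-- The parent edges of `W` provide at least `|W|` edges of `A` at `W`, and `T` has exactly `|W|`.
Containment in `T` is therefore equality. -/
theorem IsSpanningTree.inter_edgesAt_eq_iff {W : Finset G.Interior} {A T : Finset E}
    (hA : G.wired.IsSpanningTree A) (hT : (G.wiredOff W).IsSpanningTree T) :
    Disjoint A (G.edgesAt W \ T) ↔ A ∩ G.edgesAt W = T := by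
  constructor
  · intro h
    refine Finset.eq_of_subset_of_card_le (fun e he => ?_) ?_
    · obtain ⟨h1, h2⟩ := Finset.mem_inter.1 he
      by_contra h3
      exact Finset.disjoint_left.1 h h1 (Finset.mem_sdiff.2 ⟨h2, h3⟩)
    · obtain ⟨f, hf, rfl⟩ := hA.exists_parentMap
      rw [hT.card_eq, ← (hf.restrictParent W).card_image]
      exact Finset.card_le_card (hf.image_restrictParent_subset W)
  · rintro rfl
    rw [Finset.disjoint_left]
    intro e he h
    obtain ⟨h1, h2⟩ := Finset.mem_sdiff.1 h
    exact h2 (Finset.mem_inter.2 ⟨he, h1⟩)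

/-- The part of a spanning tree at `W` can be exchanged. -/
theorem IsSpanningTree.exchange {W : Finset G.Interior} {A T T₀ : Finset E}
    (hA : G.wired.IsSpanningTree A) (hT : (G.wiredOff W).IsSpanningTree T)
    (hT₀ : (G.wiredOff W).IsSpanningTree T₀) (h : A ∩ G.edgesAt W = T) :
    G.wired.IsSpanningTree (A \ T ∪ T₀) := by
  obtain ⟨f, hf, rfl⟩ := hA.exists_parentMap
  obtain ⟨g, hg, rfl⟩ := hT₀.exists_parentMap
  have hfW := hf.notMem_edgesAt (W := W) (h ▸ hT)
  have hfW' : ∀ v, v ∈ W → f v ∈ G.edgesAt W := fun v hv =>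
    (hf.restrictParent W).mem_edgesAt ⟨v, by simpa using coe_mem_toVerts.2 hv⟩
  set f' : G.Interior → E := fun v => if hv : v ∈ W then
    g ⟨v, by simpa using coe_mem_toVerts.2 hv⟩ else f v with hf'
  have hpm : G.IsParentMap G.bdry f' := by
    obtain ⟨hh, hf⟩ := hf
    obtain ⟨hh', hg⟩ := hg
    -- The shift lifts all of `W` above every outside vertex, so parents may leave `W`. No outside
    -- vertex has its parent in `W`.
    refine ⟨fun v => if v ∈ toVerts W then (∑ u, hh u) + 1 + hh' v else hh v, fun v => ?_⟩
    by_cases hv : v ∈ W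
    · obtain ⟨u, h1, h2⟩ := hg ⟨v, by simpa using coe_mem_toVerts.2 hv⟩
      refine ⟨u, by simpa only [hf', hv, dite_true] using h1, ?_⟩
      have := Finset.single_le_sum (f := hh) (fun _ _ => Nat.zero_le _) (Finset.mem_univ u)
      dsimp only at h2 ⊢
      rw [if_pos (coe_mem_toVerts.2 hv)]
      split_ifs <;> omega
    · obtain ⟨u, h1, h2⟩ := hf v
      refine ⟨u, by simpa only [hf', hv, dite_false] using h1, ?_⟩
      have hu : u ∉ toVerts W := fun hu => hfW v hv ((mem_edgesAt_of_eq h1).2 (Or.inr hu))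
      dsimp only
      rwa [if_neg hu, if_neg (mt coe_mem_toVerts.1 hv)]
  convert hpm.isSpanningTree using 1
  ext e
  simp only [← h, Finset.mem_union, Finset.mem_sdiff, Finset.mem_image, Finset.mem_univ, true_and,
    Finset.mem_inter]
  constructor
  · rintro (⟨⟨v, rfl⟩, h2⟩ | ⟨w, rfl⟩)
    · refine ⟨v, ?_⟩
      have hv : v ∉ W := fun hv => h2 ⟨⟨v, rfl⟩, hfW' v hv⟩
      simp only [hf', hv, dite_false]
    · have hw := mem_toVerts_of_notMem_compl w.2
      refine ⟨⟨w, notMem_bdry_of_mem_toVerts hw⟩, ?_⟩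
      have : (⟨w, notMem_bdry_of_mem_toVerts hw⟩ : G.Interior) ∈ W := coe_mem_toVerts.1 hw
      simp only [hf', this, dite_true]
  · rintro ⟨v, rfl⟩
    by_cases hv : v ∈ W
    · exact Or.inr ⟨⟨v, by simpa using coe_mem_toVerts.2 hv⟩, by simp only [hf', hv, dite_true]⟩
    · simp only [hf', hv, dite_false]
      exact Or.inl ⟨⟨v, rfl⟩, fun h => hfW v hv h.2⟩

theorem sdiff_union_inter_edgesAt {W : Finset G.Interior} {A T T₀ : Finset E}
    (hT₀ : T₀ ⊆ G.edgesAt W) (h : A ∩ G.edgesAt W = T) :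
    (A \ T ∪ T₀) ∩ G.edgesAt W = T₀ := by
  subst h
  ext e
  have := @hT₀ e
  simp only [Finset.mem_inter, Finset.mem_union, Finset.mem_sdiff]
  tauto

theorem exchange_exchange {W : Finset G.Interior} {A T T₀ : Finset E}
    (hT₀ : T₀ ⊆ G.edgesAt W) (h : A ∩ G.edgesAt W = T) :
    ((A \ T ∪ T₀) \ T₀) ∪ T = A := by
  subst h
  ext e
  have := @hT₀ e
  simp only [Finset.mem_inter, Finset.mem_union, Finset.mem_sdiff]
  tauto

/-- The total weight of the spanning trees which coincide with `T` at `W`. -/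
def treeSumAt (G : WeightedGraph V E) (W : Finset G.Interior) (T : Finset E) : ℝ :=
  ∑ A ∈ G.wired.spanningTrees with A ∩ G.edgesAt W = T, G.weight A

/-- Exchanging `T` for `T₀` is a bijection between the two families of wired trees that leaves the
remaining edges alone. -/
theorem treeSumAt_mul_weight {W : Finset G.Interior} {T T₀ : Finset E}
    (hT : (G.wiredOff W).IsSpanningTree T) (hT₀ : (G.wiredOff W).IsSpanningTree T₀) :
    G.treeSumAt W T * G.weight T₀ = G.treeSumAt W T₀ * G.weight T := by
  rw [treeSumAt, treeSumAt, Finset.sum_mul, Finset.sum_mul]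
  refine Finset.sum_bij' (fun A _ => A \ T ∪ T₀) (fun A _ => A \ T₀ ∪ T) ?_ ?_ ?_ ?_ ?_
  · intro A hA
    rw [Finset.mem_filter, mem_spanningTrees] at hA ⊢
    exact ⟨hA.1.exchange hT hT₀ hA.2, sdiff_union_inter_edgesAt hT₀.subset_edgesAt hA.2⟩
  · intro A hA
    rw [Finset.mem_filter, mem_spanningTrees] at hA ⊢
    exact ⟨hA.1.exchange hT₀ hT hA.2, sdiff_union_inter_edgesAt hT.subset_edgesAt hA.2⟩
  · intro A hA
    exact exchange_exchange hT₀.subset_edgesAt (Finset.mem_filter.1 hA).2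
  · intro A hA
    exact exchange_exchange hT.subset_edgesAt (Finset.mem_filter.1 hA).2
  · intro A hA
    have h := (Finset.mem_filter.1 hA).2
    have hd : Disjoint (A \ T) T₀ := by
      rw [Finset.disjoint_left]
      intro e he he'
      obtain ⟨h1, h2⟩ := Finset.mem_sdiff.1 he
      exact h2 (h ▸ Finset.mem_inter.2 ⟨h1, hT₀.subset_edgesAt he'⟩)
    unfold weight
    rw [Finset.prod_union hd, ← Finset.prod_sdiff (show T ⊆ A from h ▸ Finset.inter_subset_left)]
    ring

theorem detCompl_mul_treeSum_eq (hloop : ∀ e, G.src e ≠ G.tgt e) (h0 : G.wired.treeSum ≠ 0)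
    {W : Finset G.Interior} {T : Finset E} (hT : (G.wiredOff W).IsSpanningTree T) :
    G.detCompl (G.edgesAt W \ T) * G.wired.treeSum = G.treeSumAt W T := by
  rw [detCompl_mul_treeSum hloop h0, treeSumAt]
  refine Finset.sum_congr (Finset.filter_congr fun A hA => ?_) fun _ _ => rfl
  exact (mem_spanningTrees.1 hA).inter_edgesAt_eq_iff hT

/-- The minor of `T` is proportional to the weight of `T`. Hence each term is the minor of `T₀`
times the probability of `T` in `G_W`. -/
theorem sum_weight_div_mul_detCompl (hloop : ∀ e, G.src e ≠ G.tgt e)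
    (h0 : G.wired.treeSum ≠ 0) {W : Finset G.Interior} {T₀ : Finset E}
    (hT₀ : (G.wiredOff W).IsSpanningTree T₀) :
    ∑ T ∈ (G.wiredOff W).spanningTrees,
      (G.wiredOff W).weight T₀ / (G.wiredOff W).treeSum * G.detCompl (G.edgesAt W \ T) =
        G.detCompl (G.edgesAt W \ T₀) := by
  have hZ := (treeSum_pos hT₀).ne'
  have h1 : ∀ T ∈ (G.wiredOff W).spanningTrees,
      (G.wiredOff W).weight T₀ / (G.wiredOff W).treeSum * G.detCompl (G.edgesAt W \ T) =
        G.detCompl (G.edgesAt W \ T₀) / (G.wiredOff W).treeSum * (G.wiredOff W).weight T := by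
    intro T hT
    have hT := mem_spanningTrees.1 hT
    have h2 := treeSumAt_mul_weight hT hT₀
    rw [← detCompl_mul_treeSum_eq hloop h0 hT, ← detCompl_mul_treeSum_eq hloop h0 hT₀] at h2
    have h3 : G.weight T₀ * G.detCompl (G.edgesAt W \ T) =
        G.detCompl (G.edgesAt W \ T₀) * G.weight T := by
      refine mul_right_cancel₀ h0 ?_
      linarith
    change G.weight T₀ / _ * _ = _ / _ * G.weight T
    rw [div_mul_eq_mul_div, h3, div_mul_eq_mul_div]
  rw [Finset.sum_congr rfl h1, ← Finset.mul_sum]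
  exact div_mul_cancel₀ _ hZ

end

end WeightedGraph

/-! ### The burning bijection for a fire in two phases. -/

namespace WeightedGraph

noncomputable section

variable {V E : Type*} [Fintype V] [Fintype E] [DecidableEq V] [DecidableEq E]
  {G : WeightedGraph V E}

/-! ### Fires with two phases -/

/-- The vertex sets `B₁ k`, `B₂ k` burnt after `k` steps of the two phases of a fire which burns
everything. -/
structure IsTwoPhase (W : Finset G.Interior) (B₁ B₂ : ℕ → Finset V) : Prop where
  zero₁ : B₁ 0 = ∅
  one₁ : B₁ 1 = G.bdry
  mono₁ : Monotone B₁
  zero₂ : B₂ 0 = ∅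
  one₂ : ∀ v, v ∈ B₂ 1 ↔ ∃ k, v ∈ B₁ k
  mono₂ : Monotone B₂
  late : ∀ v, v ∉ toVerts W → v ∈ B₂ 2 → v ∈ B₂ 1
  all : ∀ v, ∃ k, v ∈ B₂ k

/-- In the sequence `B` the vertex `v` burns just after `cur`, and `old` is burnt one step before
`cur`. -/
def StageIn (B : ℕ → Finset V) (v : V) (old cur : Finset V) : Prop :=
  ∃ k, v ∈ B (k + 2) \ B (k + 1) ∧ old = B k ∧ cur = B (k + 1)

/-- The vertex `v` burns just after `cur` in one of the two phases. -/
def Stage (B₁ B₂ : ℕ → Finset V) (v : V) (old cur : Finset V) : Prop :=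
  StageIn B₁ v old cur ∨ StageIn B₂ v old cur

theorem eq_of_mem_sdiff {B : ℕ → Finset V} (hB : Monotone B) {v : V} {j k : ℕ}
    (hj : v ∈ B (j + 1) \ B j) (hk : v ∈ B (k + 1) \ B k) : j = k := by
  rw [Finset.mem_sdiff] at hj hk
  rcases lt_trichotomy j k with h | h | h
  · exact absurd (hB (show j + 1 ≤ k from h) hj.1) hk.2
  · exact h
  · exact absurd (hB (show k + 1 ≤ j from h) hk.1) hj.2

theorem exists_stageIn {B : ℕ → Finset V} (h0 : B 0 = ∅) {v : V} (h1 : v ∉ B 1)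
    (h : ∃ k, v ∈ B k) : ∃ old cur, StageIn B v old cur := by
  classical
  have hs := Nat.find_spec h
  cases hn : Nat.find h with
  | zero =>
    rw [hn, h0] at hs
    exact absurd hs (Finset.notMem_empty v)
  | succ n =>
    cases n with
    | zero =>
      rw [hn] at hs
      exact absurd hs h1
    | succ k =>
      rw [hn] at hs
      exact ⟨_, _, k, Finset.mem_sdiff.2 ⟨hs, Nat.find_min h (by omega)⟩, rfl, rfl⟩

theorem exists_forall_mem (B : ℕ → Finset V) (hB : Monotone B) :
    ∃ K, ∀ v, (∃ k, v ∈ B k) → v ∈ B K := by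
  classical
  refine ⟨∑ v, if h : ∃ k, v ∈ B k then Nat.find h else 0, fun v hv => ?_⟩
  refine hB ?_ (Nat.find_spec hv)
  have := Finset.single_le_sum (f := fun v => if h : ∃ k, v ∈ B k then Nat.find h else 0)
    (fun _ _ => Nat.zero_le _) (Finset.mem_univ v)
  simpa only [hv, dite_true] using this

namespace IsTwoPhase

variable {W : Finset G.Interior} {B₁ B₂ : ℕ → Finset V}

theorem mem_one₂ (h : G.IsTwoPhase W B₁ B₂) {k : ℕ} {v : V} (hv : v ∈ B₁ k) : v ∈ B₂ 1 :=
  (h.one₂ v).2 ⟨k, hv⟩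

theorem exists_stage (h : G.IsTwoPhase W B₁ B₂) (v : G.Interior) :
    ∃ old cur, Stage B₁ B₂ v old cur := by
  by_cases hv : (v : V) ∈ B₂ 1
  · obtain ⟨o, c, h1⟩ := exists_stageIn h.zero₁ (by rw [h.one₁]; exact v.2) ((h.one₂ v).1 hv)
    exact ⟨o, c, Or.inl h1⟩
  · obtain ⟨o, c, h1⟩ := exists_stageIn h.zero₂ hv (h.all v)
    exact ⟨o, c, Or.inr h1⟩

theorem not_stageIn (h : G.IsTwoPhase W B₁ B₂) {v : V} {o c o' c' : Finset V}
    (h1 : StageIn B₁ v o c) (h2 : StageIn B₂ v o' c') : False := by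
  obtain ⟨j, hj, -⟩ := h1
  obtain ⟨k, hk, -⟩ := h2
  rw [Finset.mem_sdiff] at hj hk
  exact hk.2 (h.mono₂ (Nat.le_add_left 1 k) (h.mem_one₂ hj.1))

theorem stage_unique (h : G.IsTwoPhase W B₁ B₂) {v : V} {o c o' c' : Finset V}
    (h1 : Stage B₁ B₂ v o c) (h2 : Stage B₁ B₂ v o' c') : o = o' ∧ c = c' := by
  have key : ∀ B : ℕ → Finset V, Monotone B → StageIn B v o c → StageIn B v o' c' →
      o = o' ∧ c = c' := by
    rintro B hB ⟨j, hj, rfl, rfl⟩ ⟨k, hk, rfl, rfl⟩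
    have := eq_of_mem_sdiff hB hj hk
    obtain rfl : j = k := by omega
    exact ⟨rfl, rfl⟩
  rcases h1 with h1 | h1 <;> rcases h2 with h2 | h2
  · exact key _ h.mono₁ h1 h2
  · exact (h.not_stageIn h1 h2).elim
  · exact (h.not_stageIn h2 h1).elim
  · exact key _ h.mono₂ h1 h2

/-- The time at which a vertex burns. -/
theorem exists_time (h : G.IsTwoPhase W B₁ B₂) :
    ∃ t : V → ℕ, (∀ k x v, x ∈ B₁ k → v ∉ B₁ k → t x < t v) ∧
      ∀ k x v, x ∈ B₂ k → v ∉ B₂ k → t x < t v := by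
  classical
  obtain ⟨K, hK⟩ := exists_forall_mem B₁ h.mono₁
  -- `K` bounds all times of the first phase, so the offset places the second phase after it.
  refine ⟨fun v => if hv : v ∈ B₂ 1 then Nat.find ((h.one₂ v).1 hv)
    else K + Nat.find (h.all v), fun k x v hx hv => ?_, fun k x v hx hv => ?_⟩
  · have hx1 := h.mem_one₂ hx
    simp only [hx1, dite_true]
    split_ifs with hv1
    · refine (Nat.find_min' _ hx).trans_lt ?_
      by_contra hle
      exact hv (h.mono₁ (not_lt.1 hle) (Nat.find_spec ((h.one₂ v).1 hv1)))
    · refine (Nat.find_min' _ (hK x ((h.one₂ x).1 hx1))).trans_lt ?_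
      refine Nat.lt_add_of_pos_right (Nat.pos_of_ne_zero fun h0 => ?_)
      have := Nat.find_spec (h.all v)
      rw [h0, h.zero₂] at this
      exact absurd this (Finset.notMem_empty v)
  · have hk : 1 ≤ k := by
      rw [Nat.one_le_iff_ne_zero]
      rintro rfl
      rw [h.zero₂] at hx
      exact absurd hx (Finset.notMem_empty x)
    have hv1 : v ∉ B₂ 1 := fun h1 => hv (h.mono₂ hk h1)
    have hvk : k < Nat.find (h.all v) := by
      by_contra hle
      exact hv (h.mono₂ (not_lt.1 hle) (Nat.find_spec (h.all v)))
    simp only [hv1, dite_false]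
    split_ifs with hx1
    · have := Nat.find_min' ((h.one₂ x).1 hx1) (hK x ((h.one₂ x).1 hx1))
      omega
    · have := Nat.find_min' (h.all x) hx
      omega

theorem exists_time_stage (h : G.IsTwoPhase W B₁ B₂) :
    ∃ t : V → ℕ, (∀ k x v, x ∈ B₁ k → v ∉ B₁ k → t x < t v) ∧
      (∀ k x v, x ∈ B₂ k → v ∉ B₂ k → t x < t v) ∧
      ∀ v o c, Stage B₁ B₂ v o c → ∀ x ∈ c, t x < t v := by
  obtain ⟨t, h1, h2⟩ := h.exists_time
  refine ⟨t, h1, h2, ?_⟩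
  rintro v o c (⟨k, hk, rfl, rfl⟩ | ⟨k, hk, rfl, rfl⟩) x hx
  · exact h1 _ x v hx (Finset.mem_sdiff.1 hk).2
  · exact h2 _ x v hx (Finset.mem_sdiff.1 hk).2

theorem old_subset (h : G.IsTwoPhase W B₁ B₂) {v : V} {o c : Finset V}
    (hs : Stage B₁ B₂ v o c) : o ⊆ c := by
  rcases hs with ⟨k, -, rfl, rfl⟩ | ⟨k, -, rfl, rfl⟩
  · exact h.mono₁ (Nat.le_succ k)
  · exact h.mono₂ (Nat.le_succ k)

/-- The phase in which a vertex burns is determined by any vertex of the preceding layer. -/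
theorem stageIn_of_mem (h : G.IsTwoPhase W B₁ B₂) {B : ℕ → Finset V} {v x : V}
    (hB : B = B₁ ∧ v ∉ toVerts W ∨ B = B₂) {o c : Finset V} (hs : Stage B₁ B₂ v o c)
    (hx : x ∈ c \ o) {k : ℕ} (hxk : x ∈ B (k + 1) \ B k) (hv : v ∉ B (k + 1)) :
    v ∈ B (k + 2) ∧ o = B k ∧ c = B (k + 1) := by
  rcases hs with ⟨j, hj, rfl, rfl⟩ | ⟨j, hj, rfl, rfl⟩
  · rcases hB with ⟨rfl, -⟩ | rfl
    · obtain rfl := eq_of_mem_sdiff h.mono₁ hx hxk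
      exact ⟨(Finset.mem_sdiff.1 hj).1, rfl, rfl⟩
    · exact absurd (h.mono₂ (Nat.le_add_left 1 k) (h.mem_one₂ (Finset.mem_sdiff.1 hj).1)) hv
  · rcases hB with ⟨rfl, hvW⟩ | rfl
    · have hx1 := h.mem_one₂ (Finset.mem_sdiff.1 hxk).1
      obtain rfl : j = 0 := by
        by_contra h0
        exact (Finset.mem_sdiff.1 hx).2 (h.mono₂ (Nat.one_le_iff_ne_zero.2 h0) hx1)
      rw [Finset.mem_sdiff] at hj
      exact absurd (h.late v hvW hj.1) hj.2
    · obtain rfl := eq_of_mem_sdiff h.mono₂ hx hxk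
      exact ⟨(Finset.mem_sdiff.1 hj).1, rfl, rfl⟩

/-- With the bound of the height by the number of edges to the complement of `o`, this shows that a
vertex does not burn before its stage. -/
theorem subset_old (h : G.IsTwoPhase W B₁ B₂) {B : ℕ → Finset V} {v : V}
    (hB : B = B₁ ∧ v ∉ toVerts W ∨ B = B₂) {o c : Finset V} (hs : Stage B₁ B₂ v o c)
    {k : ℕ} (hv : v ∉ B (k + 2)) : B (k + 1) ⊆ o := by
  have key : ∀ B : ℕ → Finset V, Monotone B → v ∉ B (k + 2) → StageIn B v o c →
      B (k + 1) ⊆ o := by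
    rintro B hB hv ⟨j, hj, rfl, rfl⟩
    refine hB ?_
    by_contra hlt
    exact hv (hB (by omega) (Finset.mem_sdiff.1 hj).1)
  rcases hs with hs | hs
  · rcases hB with ⟨rfl, -⟩ | rfl
    · exact key _ h.mono₁ hv hs
    · obtain ⟨j, hj, -⟩ := hs
      exact absurd (h.mono₂ (Nat.le_add_left 1 (k + 1)) (h.mem_one₂ (Finset.mem_sdiff.1 hj).1)) hv
  · rcases hB with ⟨rfl, hvW⟩ | rfl
    · obtain ⟨j, hj, rfl, rfl⟩ := hs
      have hj0 : j ≠ 0 := by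
        rintro rfl
        rw [Finset.mem_sdiff] at hj
        exact hj.2 (h.late v hvW hj.1)
      intro x hx
      exact h.mono₂ (Nat.one_le_iff_ne_zero.2 hj0) (h.mem_one₂ hx)
    · exact key _ h.mono₂ hv hs

end IsTwoPhase

/-! ### Edges ranked around a vertex -/

/-- The number of edges from `v` to `X` which precede `e`. -/
def position (G : WeightedGraph V E) (rank : G.Interior → E → ℕ) (v : G.Interior) (X : Finset V)
    (e : E) : ℕ :=
  ((G.edgesTo v X).filter fun f => rank v f < rank v e).card

variable {rank : G.Interior → E → ℕ}

theorem position_lt {v : G.Interior} {X : Finset V} {e : E} (he : e ∈ G.edgesTo v X) :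
    G.position rank v X e < (G.edgesTo v X).card := by
  refine Finset.card_lt_card ⟨Finset.filter_subset _ _, fun h => ?_⟩
  exact lt_irrefl _ (Finset.mem_filter.1 (h he)).2

theorem position_lt_position {v : G.Interior} {X : Finset V} {e f : E}
    (he : e ∈ G.edgesTo v X) (h : rank v e < rank v f) :
    G.position rank v X e < G.position rank v X f := by
  refine Finset.card_lt_card ⟨fun x hx => ?_, fun h' => ?_⟩
  · rw [Finset.mem_filter] at hx ⊢
    exact ⟨hx.1, hx.2.trans h⟩
  · exact lt_irrefl _ (Finset.mem_filter.1 (h' (Finset.mem_filter.2 ⟨he, h⟩))).2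

theorem position_injOn
    (hrank : ∀ v : G.Interior, Set.InjOn (rank v) (G.edgesTo (v : V) Finset.univ : Set E))
    (v : G.Interior) (X : Finset V) : Set.InjOn (G.position rank v X) (G.edgesTo (v : V) X) := by
  intro e he f hf h
  have hsub := G.edgesTo_mono (v : V) (Finset.subset_univ X)
  refine hrank v (hsub he) (hsub hf) ?_
  rcases lt_trichotomy (rank v e) (rank v f) with h1 | h1 | h1
  · exact absurd h (position_lt_position he h1).ne
  · exact h1
  · exact absurd h (position_lt_position hf h1).ne'

/-- Positions are injective on the edges from `v` to `X` and smaller than their number, so all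
values occur. -/
theorem exists_position_eq
    (hrank : ∀ v : G.Interior, Set.InjOn (rank v) (G.edgesTo (v : V) Finset.univ : Set E))
    (v : G.Interior) (X : Finset V) {i : ℕ} (hi : i < (G.edgesTo (v : V) X).card) :
    ∃ e ∈ G.edgesTo (v : V) X, G.position rank v X e = i := by
  have h1 : (G.edgesTo (v : V) X).image (G.position rank v X) =
      Finset.range (G.edgesTo (v : V) X).card := by
    refine Finset.eq_of_subset_of_card_le ?_ ?_
    · intro j hj
      obtain ⟨e, he, rfl⟩ := Finset.mem_image.1 hj
      exact Finset.mem_range.2 (position_lt he)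
    · rw [Finset.card_range, Finset.card_image_of_injOn (position_injOn hrank v X)]
  have h2 := Finset.mem_range.2 hi
  rw [← h1] at h2
  exact Finset.mem_image.1 h2

theorem exists_mem_of_mem_edgesTo {v : V} {X : Finset V} {e : E} (he : e ∈ G.edgesTo v X) :
    ∃ x ∈ X, s(G.src e, G.tgt e) = s(v, x) := by
  rcases G.mem_edgesTo.1 he with ⟨h1, h2⟩ | ⟨h1, h2⟩
  · exact ⟨_, h2, by rw [h1]⟩
  · exact ⟨_, h2, by rw [h1, Sym2.eq_swap]⟩

theorem mem_edgesTo_of_eq {v x : V} {X : Finset V} {e : E} (hx : x ∈ X)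
    (h : s(G.src e, G.tgt e) = s(v, x)) : e ∈ G.edgesTo v X := by
  rw [mem_edgesTo]
  rcases Sym2.eq_iff.1 h with ⟨h1, h2⟩ | ⟨h1, h2⟩
  · exact Or.inl ⟨h1, h2 ▸ hx⟩
  · exact Or.inr ⟨h2, h1 ▸ hx⟩

/-! ### The fire of a configuration -/

theorem mem_burnt_add_two {η : G.Interior → ℕ} {A X : Finset V} {k : ℕ} {v : V} :
    v ∈ G.burnt η A X (k + 2) ↔ v ∈ G.burnt η A X (k + 1) ∨
      (v ∈ A ∧ ∃ h : v ∉ G.bdry, (G.edgesTo v (G.burnt η A X (k + 1))ᶜ).card ≤ η ⟨v, h⟩) := by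
  rw [burnt]
  simp

theorem burnt_mono (η : G.Interior → ℕ) (A X : Finset V) : Monotone (G.burnt η A X) := by
  refine monotone_nat_of_le_succ fun k => ?_
  cases k with
  | zero => exact Finset.empty_subset _
  | succ k => exact fun v hv => mem_burnt_add_two.2 (Or.inl hv)

theorem mem_allBurnt {η : G.Interior → ℕ} {A X : Finset V} {v : V} :
    v ∈ G.allBurnt η A X ↔ ∃ k, v ∈ G.burnt η A X k := by
  simp [allBurnt]

/-- The sets burnt in the first phase. -/
def phase₁ (G : WeightedGraph V E) (W : Finset G.Interior) (η : G.Interior → ℕ) :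
    ℕ → Finset V :=
  G.burnt η (toVerts W)ᶜ G.bdry

/-- The sets burnt in the second phase. -/
def phase₂ (G : WeightedGraph V E) (W : Finset G.Interior) (η : G.Interior → ℕ) :
    ℕ → Finset V :=
  G.burnt η Finset.univ (G.allBurnt η (toVerts W)ᶜ G.bdry)

variable {W : Finset G.Interior} {η : G.Interior → ℕ}

theorem IsAllowed.isTwoPhase (hη : G.IsAllowed η) (W : Finset G.Interior) :
    G.IsTwoPhase W (G.phase₁ W η) (G.phase₂ W η) where
  zero₁ := rfl
  one₁ := rfl
  mono₁ := burnt_mono _ _ _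
  zero₂ := rfl
  one₂ v := mem_allBurnt
  mono₂ := burnt_mono _ _ _
  -- At the start of the second phase such a vertex sees the burnt set with which the first phase
  -- ended, and would have burnt then.
  late v hv h := by
    rcases mem_burnt_add_two.1 h with h1 | ⟨-, hb, h1⟩
    · exact h1
    refine mem_allBurnt.2 ?_
    obtain ⟨K, hK⟩ := exists_forall_mem (G.phase₁ W η) (burnt_mono _ _ _)
    refine ⟨K + 2, mem_burnt_add_two.2 (Or.inr ⟨Finset.mem_compl.2 hv, hb, le_trans ?_ h1⟩)⟩
    refine G.card_edgesTo_mono v (Finset.compl_subset_compl.2 fun x hx => ?_)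
    exact burnt_mono _ _ _ (Nat.le_succ K) (hK x (mem_allBurnt.1 hx))
  -- The set left unburnt would be a forbidden subconfiguration.
  all v := by
    obtain ⟨K, hK⟩ := exists_forall_mem (G.phase₂ W η) (burnt_mono _ _ _)
    by_contra hv
    have hv1 : v ∉ G.phase₂ W η (K + 1) := fun h => hv ⟨_, h⟩
    obtain ⟨u, hu, h1⟩ := hη (G.phase₂ W η (K + 1))ᶜ ⟨v, Finset.mem_compl.2 hv1⟩ (by
      refine disjoint_compl_left.mono_right fun x hx => ?_
      exact burnt_mono _ _ _ (Nat.le_add_left 1 K) (mem_allBurnt.2 ⟨1, hx⟩))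
    have h2 : (u : V) ∈ G.phase₂ W η (K + 2) :=
      mem_burnt_add_two.2 (Or.inr ⟨Finset.mem_univ _, u.2, h1⟩)
    exact (Finset.mem_compl.1 hu) (burnt_mono _ _ _ (Nat.le_succ K) (hK u ⟨K + 2, h2⟩))

/-- The lower bound is the burning rule. The upper bound says that `v` did not burn one step
earlier; when `o` is empty it is stability. -/
theorem bounds_of_stageIn (hs : G.Stable η) {A X : Finset V}
    {v : G.Interior} {o c : Finset V} (h : StageIn (G.burnt η A X) v o c) :
    (G.edgesTo (v : V) cᶜ).card ≤ η v ∧ η v < (G.edgesTo (v : V) oᶜ).card := by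
  obtain ⟨k, hk, rfl, rfl⟩ := h
  rw [Finset.mem_sdiff, mem_burnt_add_two] at hk
  obtain ⟨hA, _, h1⟩ := hk.1.resolve_left hk.2
  refine ⟨h1, ?_⟩
  cases k with
  | zero =>
    rw [burnt, Finset.compl_empty]
    exact hs v
  | succ k =>
    by_contra hle
    exact hk.2 (mem_burnt_add_two.2 (Or.inr ⟨hA, v.2, not_lt.1 hle⟩))

theorem bounds_of_stage (hs : G.Stable η) {v : G.Interior} {o c : Finset V}
    (h : Stage (G.phase₁ W η) (G.phase₂ W η) v o c) :
    (G.edgesTo (v : V) cᶜ).card ≤ η v ∧ η v < (G.edgesTo (v : V) oᶜ).card :=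
  h.elim (bounds_of_stageIn hs) (bounds_of_stageIn hs)

/-- When the first vertex of `F` burns, the whole of `F` is still unburnt, so this vertex is a
witness. -/
theorem IsTwoPhase.isAllowed (hs : G.Stable η)
    (h : G.IsTwoPhase W (G.phase₁ W η) (G.phase₂ W η)) : G.IsAllowed η := by
  intro F hF hd
  obtain ⟨t, -, -, ht⟩ := h.exists_time_stage
  obtain ⟨v, hv, hmin⟩ := Finset.exists_min_image F t hF
  obtain ⟨o, c, hoc⟩ := h.exists_stage ⟨v, Finset.disjoint_left.1 hd hv⟩
  refine ⟨⟨v, Finset.disjoint_left.1 hd hv⟩, hv, le_trans ?_ (bounds_of_stage hs hoc).1⟩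
  refine G.card_edgesTo_mono v fun x hx => Finset.mem_compl.2 fun hxc => ?_
  exact absurd (hmin x hx) (not_le.2 (ht _ _ _ hoc x hxc))

/-- In the fire of `η` the vertex `v`, which burns just after `c`, selects `e`. -/
def Selects (rank : G.Interior → E → ℕ) (η : G.Interior → ℕ) (v : G.Interior) (o c : Finset V)
    (e : E) : Prop :=
  e ∈ G.edgesTo (v : V) (c \ o) ∧
    η v = (G.edgesTo (v : V) cᶜ).card + G.position rank v (c \ o) e

theorem mem_fireEdges {A X : Finset V} {e : E} :
    e ∈ G.fireEdges rank η A X ↔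
      ∃ v o c, StageIn (G.burnt η A X) (v : G.Interior) o c ∧ Selects rank η v o c e := by
  simp only [fireEdges, Finset.mem_filter, Finset.mem_univ, true_and]
  constructor
  · rintro ⟨v, k, h1, h2, h3⟩
    exact ⟨v, _, _, ⟨k, h1, rfl, rfl⟩, h2, by rw [h3, position]⟩
  · rintro ⟨v, _, _, ⟨k, h1, rfl, rfl⟩, h2, h3⟩
    exact ⟨v, k, h1, h2, by rw [h3, position]⟩

theorem mem_burningMap {e : E} :
    e ∈ G.burningMap rank W η ↔
      ∃ v o c, Stage (G.phase₁ W η) (G.phase₂ W η) (v : G.Interior) o c ∧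
        Selects rank η v o c e := by
  rw [burningMap, Finset.mem_union, mem_fireEdges, mem_fireEdges]
  constructor
  · rintro (⟨v, o, c, h1, h2⟩ | ⟨v, o, c, h1, h2⟩)
    · exact ⟨v, o, c, Or.inl h1, h2⟩
    · exact ⟨v, o, c, Or.inr h1, h2⟩
  · rintro ⟨v, o, c, h1 | h1, h2⟩
    · exact Or.inl ⟨v, o, c, h1, h2⟩
    · exact Or.inr ⟨v, o, c, h1, h2⟩

section

variable (hloop : ∀ e, G.src e ≠ G.tgt e)
  (hrank : ∀ v : G.Interior, Set.InjOn (rank v) (G.edgesTo (v : V) Finset.univ : Set E))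

include hloop hrank

/-- The two bounds say that the surplus of `v` over its unburnt edges is a valid position among its
edges to the last layer. -/
theorem exists_selects (h : G.IsTwoPhase W (G.phase₁ W η) (G.phase₂ W η)) (hs : G.Stable η)
    {v : G.Interior} {o c : Finset V} (hoc : Stage (G.phase₁ W η) (G.phase₂ W η) v o c) :
    ∃ e, Selects rank η v o c e := by
  obtain ⟨h1, h2⟩ := bounds_of_stage hs hoc
  rw [← card_edgesTo_sdiff hloop (v : V) (h.old_subset hoc)] at h2
  obtain ⟨e, he, h3⟩ := exists_position_eq hrank v (c \ o)
    (i := η v - (G.edgesTo (v : V) cᶜ).card) (by omega)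
  exact ⟨e, he, by omega⟩

omit hloop in
theorem Selects.unique {v : G.Interior} {o c : Finset V} {e f : E}
    (he : Selects rank η v o c e) (hf : Selects rank η v o c f) : e = f := by
  refine position_injOn hrank v (c \ o) he.1 hf.1 ?_
  have := he.2
  have := hf.2
  omega

/-- The burning map, as the range of a parent map. -/
theorem exists_parentMap_burningMap (h : G.IsTwoPhase W (G.phase₁ W η) (G.phase₂ W η))
    (hs : G.Stable η) :
    ∃ f : G.Interior → E, G.IsParentMap G.bdry f ∧
      Finset.univ.image f = G.burningMap rank W η ∧
      ∀ v o c, Stage (G.phase₁ W η) (G.phase₂ W η) (v : G.Interior) o c →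
        Selects rank η v o c (f v) := by
  choose o c hoc using h.exists_stage
  choose f hf using fun v => exists_selects hloop hrank h hs (hoc v)
  obtain ⟨t, -, -, ht⟩ := h.exists_time_stage
  have hsel : ∀ v o c, Stage (G.phase₁ W η) (G.phase₂ W η) (v : G.Interior) o c →
      Selects rank η v o c (f v) := by
    intro v o' c' h'
    obtain ⟨rfl, rfl⟩ := h.stage_unique (hoc v) h'
    exact hf v
  refine ⟨f, ⟨t, fun v => ?_⟩, ?_, hsel⟩
  · obtain ⟨x, hx, h1⟩ := exists_mem_of_mem_edgesTo (hf v).1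
    exact ⟨x, h1, ht _ _ _ (hoc v) x (Finset.mem_sdiff.1 hx).1⟩
  · ext e
    rw [mem_burningMap, Finset.mem_image]
    constructor
    · rintro ⟨v, -, rfl⟩
      exact ⟨v, o v, c v, hoc v, hf v⟩
    · rintro ⟨v, o', c', h1, h2⟩
      exact ⟨v, Finset.mem_univ v, (hsel v o' c' h1).unique hrank h2⟩

theorem isSpanningTree_burningMap (h : G.IsTwoPhase W (G.phase₁ W η) (G.phase₂ W η))
    (hs : G.Stable η) : G.wired.IsSpanningTree (G.burningMap rank W η) := by
  obtain ⟨f, hf, hφ, -⟩ := exists_parentMap_burningMap hloop hrank h hs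
  exact hφ ▸ hf.isSpanningTree

end

/-! ### The fire of a spanning tree -/

/-- Successive sets reached from `X` along edges of `T`, where new vertices are in `A`. -/
def treeFire (G : WeightedGraph V E) (T : Finset E) (A X : Finset V) : ℕ → Finset V
  | 0 => ∅
  | 1 => X
  | k + 2 => open Classical in treeFire G T A X (k + 1) ∪ Finset.univ.filter fun v => v ∈ A ∧
      v ∉ G.bdry ∧ ∃ e ∈ T, e ∈ G.edgesTo v (treeFire G T A X (k + 1) \ treeFire G T A X k)

theorem mem_treeFire_add_two {T : Finset E} {A X : Finset V} {k : ℕ} {v : V} :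
    v ∈ G.treeFire T A X (k + 2) ↔ v ∈ G.treeFire T A X (k + 1) ∨ (v ∈ A ∧ v ∉ G.bdry ∧
      ∃ e ∈ T, e ∈ G.edgesTo v (G.treeFire T A X (k + 1) \ G.treeFire T A X k)) := by
  rw [treeFire]
  simp

theorem treeFire_mono (T : Finset E) (A X : Finset V) : Monotone (G.treeFire T A X) := by
  refine monotone_nat_of_le_succ fun k => ?_
  cases k with
  | zero => exact Finset.empty_subset _
  | succ k => exact fun v hv => mem_treeFire_add_two.2 (Or.inl hv)

/-- A sequence of sets is the fire of a configuration and of a set of edges at the same time as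
soon as, for one of them, the two rules agree. -/
theorem burnt_eq_treeFire {T : Finset E} {A X : Finset V} (B : ℕ → Finset V)
    (hB : B = G.burnt η A X ∨ B = G.treeFire T A X)
    (h : ∀ k (v : G.Interior), (v : V) ∈ A → (v : V) ∉ B (k + 1) →
      ((G.edgesTo v (B (k + 1))ᶜ).card ≤ η v ↔
        ∃ e ∈ T, e ∈ G.edgesTo v (B (k + 1) \ B k))) :
    G.burnt η A X = G.treeFire T A X := by
  have key : ∀ k, G.burnt η A X k = G.treeFire T A X k ∧
      G.burnt η A X (k + 1) = G.treeFire T A X (k + 1) := by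
    intro k
    induction k with
    | zero => exact ⟨rfl, rfl⟩
    | succ k ih =>
      refine ⟨ih.2, ?_⟩
      have hk : B k = G.burnt η A X k := by
        rcases hB with rfl | rfl
        · rfl
        · exact ih.1.symm
      have hk1 : B (k + 1) = G.burnt η A X (k + 1) := by
        rcases hB with rfl | rfl
        · rfl
        · exact ih.2.symm
      ext v
      rw [mem_burnt_add_two, mem_treeFire_add_two, ← ih.1, ← ih.2]
      refine or_congr_right' fun hv => and_congr_right fun hA => ?_
      have h1 := h k
      rw [hk1, hk] at h1
      constructor
      · rintro ⟨hb, h2⟩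
        exact ⟨hb, (h1 ⟨v, hb⟩ hA hv).1 h2⟩
      · rintro ⟨hb, h2⟩
        exact ⟨hb, (h1 ⟨v, hb⟩ hA hv).2 h2⟩
  exact funext fun k => (key k).1

/-- The sets reached in the first phase. -/
def treePhase₁ (G : WeightedGraph V E) (W : Finset G.Interior) (T : Finset E) : ℕ → Finset V :=
  G.treeFire T (toVerts W)ᶜ G.bdry

/-- The sets reached in the second phase. -/
def treePhase₂ (G : WeightedGraph V E) (W : Finset G.Interior) (T : Finset E) : ℕ → Finset V :=
  open Classical in G.treeFire T Finset.univ
    (Finset.univ.filter fun v => ∃ k, v ∈ G.treePhase₁ W T k)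

theorem phases_eq {T : Finset E} (h₁ : G.phase₁ W η = G.treePhase₁ W T)
    (h₂ : ∀ X, X = G.allBurnt η (toVerts W)ᶜ G.bdry →
      G.burnt η Finset.univ X = G.treeFire T Finset.univ X) :
    G.phase₂ W η = G.treePhase₂ W T := by
  rw [phase₂, treePhase₂, h₂ _ rfl]
  congr 1
  ext v
  rw [mem_allBurnt]
  change (∃ k, v ∈ G.phase₁ W η k) ↔ _
  rw [h₁]
  simp

/-- Completeness is induction along a parent map: once a parent is reached, the child follows at the
latest one step later. An outside vertex joined by a tree edge to the first phase is reached in that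
phase already. -/
theorem IsSpanningTree.isTwoPhase {T : Finset E} (hT : G.wired.IsSpanningTree T)
    (W : Finset G.Interior) :
    G.IsTwoPhase W (G.treePhase₁ W T) (G.treePhase₂ W T) where
  zero₁ := rfl
  one₁ := rfl
  mono₁ := treeFire_mono _ _ _
  zero₂ := rfl
  one₂ v := by
    classical
    change v ∈ Finset.univ.filter (fun v => ∃ k, v ∈ G.treePhase₁ W T k) ↔ _
    simp
  mono₂ := treeFire_mono _ _ _
  late v hv h := by
    classical
    by_contra h1
    have h0 : ∀ v, v ∈ G.treePhase₂ W T 1 ↔ ∃ k, v ∈ G.treePhase₁ W T k := fun v => by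
      change v ∈ Finset.univ.filter (fun v => ∃ k, v ∈ G.treePhase₁ W T k) ↔ _
      simp
    obtain ⟨-, hb, e, he, he'⟩ := (mem_treeFire_add_two.1 h).resolve_left h1
    obtain ⟨x, hx, hex⟩ := exists_mem_of_mem_edgesTo he'
    have hx1 := (h0 x).1 (Finset.mem_sdiff.1 hx).1
    have hs := Nat.find_spec hx1
    cases hn : Nat.find hx1 with
    | zero =>
      rw [hn] at hs
      exact absurd hs (Finset.notMem_empty x)
    | succ n =>
      rw [hn] at hs
      refine h1 ((h0 v).2 ⟨n + 2, mem_treeFire_add_two.2 (Or.inr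
        ⟨Finset.mem_compl.2 hv, hb, e, he, mem_edgesTo_of_eq (Finset.mem_sdiff.2 ⟨hs, ?_⟩) hex⟩)⟩)
      exact Nat.find_min hx1 (by omega)
  all v := by
    classical
    obtain ⟨f, ⟨h, hf⟩, rfl⟩ := hT.exists_parentMap
    have hbd : ∀ v ∈ G.bdry, ∃ k, v ∈ G.treePhase₂ W (Finset.univ.image f) k := by
      intro v hv
      refine ⟨1, ?_⟩
      change v ∈ Finset.univ.filter (fun v => ∃ k, v ∈ G.treePhase₁ W (Finset.univ.image f) k)
      simp only [Finset.mem_filter, Finset.mem_univ, true_and]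
      exact ⟨1, hv⟩
    have key : ∀ n v, h v = n → ∃ k, v ∈ G.treePhase₂ W (Finset.univ.image f) k := by
      intro n
      induction n using Nat.strong_induction_on with
      | _ n ih =>
        intro v hn
        by_cases hv : v ∈ G.bdry
        · exact hbd v hv
        obtain ⟨u, hu, hlt⟩ := hf ⟨v, hv⟩
        have hx1 := ih (h u) (hn ▸ hlt) u rfl
        have hs := Nat.find_spec hx1
        cases hn : Nat.find hx1 with
        | zero =>
          rw [hn] at hs
          exact absurd hs (Finset.notMem_empty u)
        | succ n =>
          rw [hn] at hs
          refine ⟨n + 2, mem_treeFire_add_two.2 (Or.inr ⟨Finset.mem_univ _, hv, f ⟨v, hv⟩,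
            Finset.mem_image_of_mem f (Finset.mem_univ _),
            mem_edgesTo_of_eq (Finset.mem_sdiff.2 ⟨hs, ?_⟩) hu⟩)⟩
          exact Nat.find_min hx1 (by omega)
    exact key _ v rfl

section

variable (hloop : ∀ e, G.src e ≠ G.tgt e)
  (hrank : ∀ v : G.Interior, Set.InjOn (rank v) (G.edgesTo (v : V) Finset.univ : Set E))

include hloop hrank

/-- A selected edge is selected by its later end. Here this is `v`, and the layer containing the
other end identifies the stage. -/
theorem selects_of_mem_burningMap (h : G.IsTwoPhase W (G.phase₁ W η) (G.phase₂ W η))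
    {B : ℕ → Finset V} {v : G.Interior}
    (hB : B = G.phase₁ W η ∧ (v : V) ∉ toVerts W ∨ B = G.phase₂ W η) {k : ℕ}
    (hv : (v : V) ∉ B (k + 1)) {e : E} (he : e ∈ G.burningMap rank W η)
    (hev : e ∈ G.edgesTo (v : V) (B (k + 1) \ B k)) :
    (v : V) ∈ B (k + 2) ∧ Selects rank η v (B k) (B (k + 1)) e := by
  obtain ⟨t, ht₁, ht₂, ht⟩ := h.exists_time_stage
  obtain ⟨u, o, c, hs, hsel⟩ := mem_burningMap.1 he
  obtain ⟨x, hx, hex⟩ := exists_mem_of_mem_edgesTo hev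
  obtain ⟨y, hy, hey⟩ := exists_mem_of_mem_edgesTo hsel.1
  have htx : t x < t v := by
    rcases hB with ⟨rfl, -⟩ | rfl
    · exact ht₁ _ _ _ (Finset.mem_sdiff.1 hx).1 hv
    · exact ht₂ _ _ _ (Finset.mem_sdiff.1 hx).1 hv
  have hty := ht _ _ _ hs y (Finset.mem_sdiff.1 hy).1
  rw [hex] at hey
  rcases Sym2.eq_iff.1 hey with ⟨h1, rfl⟩ | ⟨h1, h2⟩
  · obtain rfl := Subtype.ext h1
    obtain ⟨h3, rfl, rfl⟩ := h.stageIn_of_mem hB hs hy hx hv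
    exact ⟨h3, hsel⟩
  · rw [h2, h1] at htx
    exact absurd hty htx.asymm

/-- The selected edges alone determine the fire, since an unburnt vertex burns next exactly when a
selected edge joins it to the last layer. -/
theorem burnt_eq_treeFire_burningMap (h : G.IsTwoPhase W (G.phase₁ W η) (G.phase₂ W η))
    (hs : G.Stable η) :
    G.phase₁ W η = G.treePhase₁ W (G.burningMap rank W η) ∧
      G.phase₂ W η = G.treePhase₂ W (G.burningMap rank W η) := by
  have h₁ : G.phase₁ W η = G.treePhase₁ W (G.burningMap rank W η) := by
    refine burnt_eq_treeFire (G.phase₁ W η) (Or.inl rfl) fun k v hA hv => ⟨fun hle => ?_, ?_⟩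
    · have hst : Stage (G.phase₁ W η) (G.phase₂ W η) v (G.phase₁ W η k) (G.phase₁ W η (k + 1)) :=
        Or.inl ⟨k, Finset.mem_sdiff.2 ⟨mem_burnt_add_two.2 (Or.inr ⟨hA, v.2, hle⟩), hv⟩, rfl, rfl⟩
      obtain ⟨e, he⟩ := exists_selects hloop hrank h hs hst
      exact ⟨e, mem_burningMap.2 ⟨v, _, _, hst, he⟩, he.1⟩
    · rintro ⟨e, he, hev⟩
      have h1 := (selects_of_mem_burningMap hloop hrank h
        (Or.inl ⟨rfl, Finset.mem_compl.1 hA⟩) hv he hev).2.2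
      omega
  refine ⟨h₁, phases_eq h₁ ?_⟩
  rintro _ rfl
  refine burnt_eq_treeFire (G.phase₂ W η) (Or.inl rfl) fun k v hA hv => ⟨fun hle => ?_, ?_⟩
  · have hst : Stage (G.phase₁ W η) (G.phase₂ W η) v (G.phase₂ W η k) (G.phase₂ W η (k + 1)) :=
      Or.inr ⟨k, Finset.mem_sdiff.2 ⟨mem_burnt_add_two.2 (Or.inr ⟨hA, v.2, hle⟩), hv⟩, rfl, rfl⟩
    obtain ⟨e, he⟩ := exists_selects hloop hrank h hs hst
    exact ⟨e, mem_burningMap.2 ⟨v, _, _, hst, he⟩, he.1⟩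
  · rintro ⟨e, he, hev⟩
    have h1 := (selects_of_mem_burningMap hloop hrank h (Or.inr rfl) hv he hev).2.2
    omega

/-- Equal trees give equal fires and equal parent maps, and the selection rule then returns the
heights. -/
theorem burningMap_injective {η' : G.Interior → ℕ}
    (h : G.IsTwoPhase W (G.phase₁ W η) (G.phase₂ W η))
    (h' : G.IsTwoPhase W (G.phase₁ W η') (G.phase₂ W η')) (hs : G.Stable η) (hs' : G.Stable η')
    (heq : G.burningMap rank W η = G.burningMap rank W η') : η = η' := by
  obtain ⟨h1, h2⟩ := burnt_eq_treeFire_burningMap hloop hrank h hs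
  obtain ⟨h3, h4⟩ := burnt_eq_treeFire_burningMap hloop hrank h' hs'
  rw [heq, ← h3] at h1
  rw [heq, ← h4] at h2
  obtain ⟨f, hf, hφ, hsel⟩ := exists_parentMap_burningMap hloop hrank h hs
  obtain ⟨f', hf', hφ', hsel'⟩ := exists_parentMap_burningMap hloop hrank h' hs'
  have hff : f = f' := hf.eq_of_image_subset hf' (by rw [hφ, hφ', heq])
  funext v
  obtain ⟨o, c, hoc⟩ := h.exists_stage v
  have e1 := (hsel v o c hoc).2
  rw [h1, h2] at hoc
  rw [e1, (hsel' v o c hoc).2, hff]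

theorem exists_burningMap_eq {T : Finset E} (hT : G.wired.IsSpanningTree T)
    (W : Finset G.Interior) :
    ∃ η, G.Stable η ∧ G.IsAllowed η ∧ G.burningMap rank W η = T := by
  have h := hT.isTwoPhase W
  choose o c hoc using h.exists_stage
  have hex : ∀ v : G.Interior, ∃ e ∈ T, e ∈ G.edgesTo (v : V) (c v \ o v) := by
    intro v
    have key : ∀ A X, StageIn (G.treeFire T A X) v (o v) (c v) →
        ∃ e ∈ T, e ∈ G.edgesTo (v : V) (c v \ o v) := by
      rintro A X ⟨k, hk, h1, h2⟩
      rw [Finset.mem_sdiff, mem_treeFire_add_two] at hk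
      rw [h1, h2]
      exact (hk.1.resolve_left hk.2).2.2
    exact (hoc v).elim (key _ _) (key _ _)
  choose f hfT hf using hex
  -- The height is forced by the selection rule, read along the fire of `T`. It remains to see that
  -- the fire of `η` is the fire of `T`.
  set η : G.Interior → ℕ := fun v =>
    (G.edgesTo (v : V) (c v)ᶜ).card + G.position rank v (c v \ o v) (f v) with hη
  have hlt : ∀ v, η v < (G.edgesTo (v : V) (o v)ᶜ).card := fun v => by
    rw [← card_edgesTo_sdiff hloop (v : V) (h.old_subset (hoc v))]
    exact Nat.add_lt_add_left (position_lt (hf v)) _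
  have hs : G.Stable η := fun v => (hlt v).trans_le (G.card_edgesTo_le_deg _ _)
  have key : ∀ B : ℕ → Finset V, ∀ A X, B = G.treeFire T A X → ∀ v : G.Interior, (v : V) ∈ A →
      (B = G.treePhase₁ W T ∧ (v : V) ∉ toVerts W ∨ B = G.treePhase₂ W T) → ∀ k,
      (v : V) ∉ B (k + 1) → ((G.edgesTo v (B (k + 1))ᶜ).card ≤ η v ↔
        ∃ e ∈ T, e ∈ G.edgesTo v (B (k + 1) \ B k)) := by
    intro B A X hBA v hA hB k hv
    have h1 : (v : V) ∈ B (k + 2) ↔ ∃ e ∈ T, e ∈ G.edgesTo v (B (k + 1) \ B k) := by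
      rw [hBA, mem_treeFire_add_two, ← hBA, or_iff_right hv]
      simp [hA, v.2]
    rw [← h1]
    constructor
    · intro hle
      by_contra hv2
      have h2 := G.card_edgesTo_mono (v : V)
        (Finset.compl_subset_compl.2 (h.subset_old hB (hoc v) hv2))
      have := hlt v
      omega
    · intro hv2
      have hst : Stage (G.treePhase₁ W T) (G.treePhase₂ W T) v (B k) (B (k + 1)) := by
        have h3 : StageIn B v (B k) (B (k + 1)) := ⟨k, Finset.mem_sdiff.2 ⟨hv2, hv⟩, rfl, rfl⟩
        rcases hB with ⟨rfl, -⟩ | rfl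
        · exact Or.inl h3
        · exact Or.inr h3
      rw [← (h.stage_unique (hoc v) hst).2]
      exact Nat.le_add_right _ _
  have h₁ : G.phase₁ W η = G.treePhase₁ W T :=
    burnt_eq_treeFire (G.treePhase₁ W T) (Or.inr rfl) fun k v hA hv =>
      key _ _ _ rfl v hA (Or.inl ⟨rfl, Finset.mem_compl.1 hA⟩) k hv
  have hX : G.treePhase₂ W T =
      G.treeFire T Finset.univ (G.allBurnt η (toVerts W)ᶜ G.bdry) := by
    rw [treePhase₂]
    congr 1
    ext v
    rw [mem_allBurnt]
    change _ ↔ ∃ k, v ∈ G.phase₁ W η k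
    rw [h₁]
    simp
  have h₂ : G.phase₂ W η = G.treePhase₂ W T := by
    refine phases_eq h₁ ?_
    rintro _ rfl
    exact burnt_eq_treeFire (G.treePhase₂ W T) (Or.inr hX) fun k v hA hv =>
      key _ _ _ hX v hA (Or.inr rfl) k hv
  have h' : G.IsTwoPhase W (G.phase₁ W η) (G.phase₂ W η) := by rwa [h₁, h₂]
  refine ⟨η, hs, h'.isAllowed hs,
    (isSpanningTree_burningMap hloop hrank h' hs).eq_of_subset hT fun e he => ?_⟩
  obtain ⟨v, o', c', hst, hsel⟩ := mem_burningMap.1 he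
  rw [h₁, h₂] at hst
  obtain ⟨rfl, rfl⟩ := h.stage_unique (hoc v) hst
  rw [hsel.unique hrank (f := f v) ⟨hf v, rfl⟩]
  exact hfT v

/-- The burning bijection. -/
theorem bijOn_burningMap (hconn : G.IsConn) (hbdry : G.bdry.Nonempty) (W : Finset G.Interior) :
    Set.BijOn (G.burningMap rank W) {η | G.Recurrent η} {A | G.wired.IsSpanningTree A} := by
  have h2 : ∀ η, G.Recurrent η → G.IsTwoPhase W (G.phase₁ W η) (G.phase₂ W η) := fun η hη =>
    (hη.isAllowed hloop hconn hbdry).isTwoPhase W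
  refine ⟨fun η hη => ?_, fun η hη η' hη' heq => ?_, fun T hT => ?_⟩
  · exact isSpanningTree_burningMap hloop hrank (h2 η hη) hη.1
  · exact burningMap_injective hloop hrank (h2 η hη) (h2 η' hη') hη.1 hη'.1 heq
  · obtain ⟨η, hs, ha, rfl⟩ := exists_burningMap_eq hloop hrank hT W
    exact ⟨η, ha.recurrent hloop hconn hbdry hs, rfl⟩

end

end

end WeightedGraph

/-! ### Minimality, and the part of the tree at `W`. -/

namespace WeightedGraph

noncomputable section

variable {V E : Type*} [Fintype V] [Fintype E] [DecidableEq V] [DecidableEq E]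
  {G : WeightedGraph V E} {rank : G.Interior → E → ℕ} {W : Finset G.Interior}
  {η η' : G.Interior → ℕ}

/-! ### Locality of the fire -/

theorem burnt_congr {A X : Finset V}
    (h : ∀ v : G.Interior, (v : V) ∈ A → (v : V) ∉ X → η v = η' v) :
    G.burnt η A X = G.burnt η' A X := by
  funext k
  induction k with
  | zero => rfl
  | succ k ih =>
    cases k with
    | zero => rfl
    | succ k =>
      ext v
      rw [mem_burnt_add_two, mem_burnt_add_two, ih]
      refine or_congr_right' fun hv => and_congr_right fun hA => exists_congr fun hb => ?_
      rw [h ⟨v, hb⟩ hA fun hX => hv (burnt_mono _ _ _ (Nat.le_add_left 1 k) hX)]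

theorem StageIn.mem_of_burnt {A X : Finset V} {v : V} {o c : Finset V}
    (h : StageIn (G.burnt η A X) v o c) : v ∈ A ∧ v ∉ X := by
  obtain ⟨k, hk, -⟩ := h
  rw [Finset.mem_sdiff, mem_burnt_add_two] at hk
  exact ⟨(hk.1.resolve_left hk.2).1, fun hX => hk.2 (burnt_mono _ _ _ (Nat.le_add_left 1 k) hX)⟩

theorem fireEdges_congr {A X : Finset V}
    (h : ∀ v : G.Interior, (v : V) ∈ A → (v : V) ∉ X → η v = η' v) :
    G.fireEdges rank η A X = G.fireEdges rank η' A X := by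
  ext e
  rw [mem_fireEdges, mem_fireEdges, burnt_congr h]
  refine exists_congr fun v => exists_congr fun o => exists_congr fun c =>
    and_congr_right fun hs => ?_
  rw [Selects, Selects, h v hs.mem_of_burnt.1 hs.mem_of_burnt.2]

theorem notMem_toVerts_of_mem_phase₁ {k : ℕ} {v : V} (hv : v ∈ G.phase₁ W η k) :
    v ∉ toVerts W := by
  induction k with
  | zero => exact absurd hv (Finset.notMem_empty v)
  | succ k ih =>
    cases k with
    | zero => exact fun h => notMem_bdry_of_mem_toVerts h hv
    | succ k =>
      rcases mem_burnt_add_two.1 hv with h | h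
      · exact ih h
      · exact Finset.mem_compl.1 h.1

theorem allBurnt_subset : G.allBurnt η (toVerts W)ᶜ G.bdry ⊆ (toVerts W)ᶜ := fun v hv => by
  obtain ⟨k, hk⟩ := mem_allBurnt.1 hv
  exact Finset.mem_compl.2 (notMem_toVerts_of_mem_phase₁ hk)

theorem disjoint_fireEdges_edgesAt :
    Disjoint (G.fireEdges rank η (toVerts W)ᶜ G.bdry) (G.edgesAt W) := by
  rw [Finset.disjoint_left]
  intro e he heW
  obtain ⟨v, o, c, hs, hsel⟩ := mem_fireEdges.1 he
  obtain ⟨x, hx, hex⟩ := exists_mem_of_mem_edgesTo hsel.1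
  rcases (mem_edgesAt_of_eq hex).1 heW with h | h
  · exact Finset.mem_compl.1 hs.mem_of_burnt.1 h
  · obtain ⟨k, -, rfl, rfl⟩ := hs
    exact notMem_toVerts_of_mem_phase₁ (Finset.mem_sdiff.1 hx).1 h

theorem fireEdges_subset_edgesAt :
    G.fireEdges rank η Finset.univ (toVerts W)ᶜ ⊆ G.edgesAt W := by
  intro e he
  obtain ⟨v, o, c, hs, hsel⟩ := mem_fireEdges.1 he
  obtain ⟨x, hx, hex⟩ := exists_mem_of_mem_edgesTo hsel.1
  exact (mem_edgesAt_of_eq hex).2 (Or.inl (mem_toVerts_of_notMem_compl hs.mem_of_burnt.2))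

theorem burningMap_inter_edgesAt (hX : G.allBurnt η (toVerts W)ᶜ G.bdry = (toVerts W)ᶜ) :
    G.burningMap rank W η ∩ G.edgesAt W = G.fireEdges rank η Finset.univ (toVerts W)ᶜ := by
  rw [burningMap, hX, Finset.union_inter_distrib_right,
    Finset.disjoint_iff_inter_eq_empty.1 disjoint_fireEdges_edgesAt, Finset.empty_union,
    Finset.inter_eq_left.2 fireEdges_subset_edgesAt]

/-- If some vertex outside `W` does not burn in the first phase, then some such vertex is
ignited by a vertex of `W`. -/
theorem IsTwoPhase.exists_ignited (h : G.IsTwoPhase W (G.phase₁ W η) (G.phase₂ W η))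
    {f : G.Interior → E} (hf : ∀ v o c, Stage (G.phase₁ W η) (G.phase₂ W η) (v : G.Interior) o c →
      Selects rank η v o c (f v))
    (hX : G.allBurnt η (toVerts W)ᶜ G.bdry ≠ (toVerts W)ᶜ) :
    ∃ (v : G.Interior) (k : ℕ) (x : V), v ∉ W ∧
      (v : V) ∈ G.phase₂ W η (k + 2) \ G.phase₂ W η (k + 1) ∧ x ∈ toVerts W ∧
      x ∈ G.phase₂ W η (k + 1) \ G.phase₂ W η k ∧ s(G.src (f v), G.tgt (f v)) = s((v : V), x) := by
  obtain ⟨t, -, -, ht⟩ := h.exists_time_stage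
  have hne : ((toVerts W)ᶜ \ G.allBurnt η (toVerts W)ᶜ G.bdry).Nonempty := by
    rw [Finset.sdiff_nonempty]
    exact fun hsub => hX (Finset.Subset.antisymm allBurnt_subset hsub)
  -- For the earliest of the outside vertices missed by the first phase, the igniting vertex cannot
  -- be outside `W`: it would be an earlier missed one, or belong to the first phase, which `late`
  -- excludes.
  obtain ⟨v, hv, hmin⟩ := Finset.exists_min_image _ t hne
  obtain ⟨hvW, hvX⟩ := Finset.mem_sdiff.1 hv
  have hvW' := Finset.mem_compl.1 hvW
  have hvb : v ∉ G.bdry := fun hb => hvX (mem_allBurnt.2 ⟨1, hb⟩)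
  obtain ⟨o, c, hs⟩ := h.exists_stage ⟨v, hvb⟩
  obtain ⟨x, hx, hex⟩ := exists_mem_of_mem_edgesTo (hf _ _ _ hs).1
  have htx := ht _ _ _ hs x (Finset.mem_sdiff.1 hx).1
  rcases hs with ⟨k, hk, -⟩ | ⟨k, hk, rfl, rfl⟩
  · exact absurd (mem_allBurnt.2 ⟨_, (Finset.mem_sdiff.1 hk).1⟩) hvX
  · refine ⟨⟨v, hvb⟩, k, x, fun h => hvW' (coe_mem_toVerts.2 h), hk, ?_, hx, hex⟩
    have hk0 : 1 ≤ k := by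
      rw [Nat.one_le_iff_ne_zero]
      rintro rfl
      exact hvX (h.late v hvW' (Finset.mem_sdiff.1 hk).1)
    by_contra hxW
    have hxX : x ∉ G.allBurnt η (toVerts W)ᶜ G.bdry := fun hxX =>
      (Finset.mem_sdiff.1 hx).2 (h.mono₂ hk0 hxX)
    exact absurd (hmin x (Finset.mem_sdiff.2 ⟨Finset.mem_compl.2 hxW, hxX⟩)) (not_le.2 htx)

/-! ### Minimal subconfigurations -/

/-- A path to the boundary that avoids `W` leaves `F` at a vertex outside `W`. With height `deg - 1`
that vertex shows `F` not to be forbidden. -/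
theorem exists_card_edgesTo_lt_of_notMem (hloop : ∀ e, G.src e ≠ G.tgt e)
    (hW : ∀ v ∉ WeightedGraph.toVerts W, ∃ b ∈ G.bdry,
      ∃ p : (G.simple Finset.univ).Walk v b, ∀ x ∈ p.support, x ∉ WeightedGraph.toVerts W)
    {F : Finset V} (hd : Disjoint F G.bdry) {v : V} (hv : v ∈ F) (hvW : v ∉ toVerts W) :
    ∃ u ∈ F, u ∉ toVerts W ∧ (G.edgesTo u F).card < G.deg u := by
  obtain ⟨b, hb, p, hp⟩ := hW v hvW
  obtain ⟨u, hu, hup, h⟩ := exists_edgesTo_compl_of_walk p hv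
    (fun h => Finset.disjoint_left.1 hd h hb)
  exact ⟨u, hu, hp u hup, card_edgesTo_lt_deg hloop h⟩

theorem mem_recurrentConfigs : η ∈ G.recurrentConfigs ↔ G.Recurrent η := by
  simp only [recurrentConfigs, Finset.mem_filter, Fintype.mem_piFinset, Finset.mem_range]
  exact ⟨fun h => h.2, fun h => ⟨h.1, h⟩⟩

section

variable (hloop : ∀ e, G.src e ≠ G.tgt e) (hconn : G.IsConn) (hbdry : G.bdry.Nonempty)
  (hrank : ∀ v : G.Interior, Set.InjOn (rank v) (G.edgesTo (v : V) Finset.univ : Set E))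

include hloop hconn hbdry hrank

/-- If `w` in `W` ignites an outside vertex `v`, lowering `w` by one and making all outside heights
maximal leaves an allowed configuration, against minimality. -/
theorem IsMinimal.allBurnt_eq
    (hW : ∀ v ∉ WeightedGraph.toVerts W, ∃ b ∈ G.bdry,
      ∃ p : (G.simple Finset.univ).Walk v b, ∀ x ∈ p.support, x ∉ WeightedGraph.toVerts W)
    {ξ : W → ℕ} (hξ : G.IsMinimal ξ) (hη : G.Recurrent η) (hr : RestrictsTo η ξ) :
    G.allBurnt η (toVerts W)ᶜ G.bdry = (toVerts W)ᶜ := by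
  by_contra hX
  have h := (hη.isAllowed hloop hconn hbdry).isTwoPhase W
  obtain ⟨f, -, -, hsel⟩ := exists_parentMap_burningMap hloop hrank h hη.1
  obtain ⟨v, k, x, hvW, hv, hxW, hx, hex⟩ := h.exists_ignited hsel hX
  set w : G.Interior := ⟨x, notMem_bdry_of_mem_toVerts hxW⟩ with hw
  have hwW : w ∈ W := coe_mem_toVerts.1 hxW
  cases k with
  | zero =>
    exact absurd hxW (Finset.mem_compl.1 (allBurnt_subset (Finset.mem_sdiff.1 hx).1))
  | succ j =>
  have hsw : Stage (G.phase₁ W η) (G.phase₂ W η) w (G.phase₂ W η j) (G.phase₂ W η (j + 1)) :=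
    Or.inr ⟨j, hx, rfl, rfl⟩
  have hvj : (v : V) ∈ (G.phase₂ W η (j + 1))ᶜ := Finset.mem_compl.2 fun h1 =>
    (Finset.mem_sdiff.1 hv).2 (h.mono₂ (Nat.le_succ _) h1)
  -- When `w` burns, its edge to `v` still counts as unburnt. Leaving out `v` makes the burning
  -- inequality strict.
  have hlt : (G.edgesTo x ((G.phase₂ W η (j + 1))ᶜ.erase v)).card < η w := by
    have h1 := card_edgesTo_erase hloop x hvj
    have h2 : 0 < (G.edgesTo (v : V) {x}).card :=
      Finset.card_pos.2 ⟨f v, mem_edgesTo_of_eq (Finset.mem_singleton_self x) hex⟩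
    have h3 := (bounds_of_stage hη.1 hsw).1
    change (G.edgesTo x _).card ≤ _ at h3
    omega
  set ζ : G.Interior → ℕ := fun u =>
    if u ∈ W then (if u = w then η w - 1 else η u) else G.deg u - 1 with hζ
  have hstab : G.Stable ζ := by
    intro u
    have h1 := hη.1 u
    have h2 := hη.1 w
    have h3 := deg_pos hloop hconn hbdry u
    simp only [hζ]
    split_ifs with h4 h5
    · subst h5
      omega
    · exact h1
    · omega
  have hall : G.IsAllowed ζ := by
    intro F hF hd
    -- Inside `W` the first vertex of `F` to burn is a witness, even if it is the lowered `w`,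
    -- because `v` is not in `F`. Any other `F` has a witness outside `W`.
    by_cases hFW : F ⊆ toVerts W
    · obtain ⟨t, -, -, ht⟩ := h.exists_time_stage
      obtain ⟨u, hu, hmin⟩ := Finset.exists_min_image F t hF
      obtain ⟨o, c, hoc⟩ := h.exists_stage ⟨u, Finset.disjoint_left.1 hd hu⟩
      have hFc : F ⊆ cᶜ := fun y hy => Finset.mem_compl.2 fun hyc =>
        absurd (hmin y hy) (not_le.2 (ht _ _ _ hoc y hyc))
      have huW : (⟨u, Finset.disjoint_left.1 hd hu⟩ : G.Interior) ∈ W :=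
        coe_mem_toVerts.1 (hFW hu)
      refine ⟨⟨u, Finset.disjoint_left.1 hd hu⟩, hu, ?_⟩
      simp only [hζ, huW, if_true]
      split_ifs with huw
      · obtain rfl : u = x := congrArg Subtype.val huw
        obtain ⟨-, rfl⟩ := h.stage_unique hoc hsw
        have h1 : F ⊆ (G.phase₂ W η (j + 1))ᶜ.erase v := fun y hy =>
          Finset.mem_erase.2 ⟨by rintro rfl; exact hvW (coe_mem_toVerts.1 (hFW hy)), hFc hy⟩
        have h2 := G.card_edgesTo_mono u h1
        omega
      · exact (G.card_edgesTo_mono u hFc).trans (bounds_of_stage hη.1 hoc).1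
    · obtain ⟨y, hy, hyW⟩ := Finset.not_subset.1 hFW
      obtain ⟨u, hu, huW, h1⟩ := exists_card_edgesTo_lt_of_notMem hloop hW hd hy hyW
      have huW' : (⟨u, Finset.disjoint_left.1 hd hu⟩ : G.Interior) ∉ W :=
        fun h => huW (coe_mem_toVerts.2 h)
      refine ⟨⟨u, Finset.disjoint_left.1 hd hu⟩, hu, ?_⟩
      simp only [hζ, huW', if_false]
      omega
  refine hξ.2 ⟨w, hwW⟩ (η w - 1) ?_ ⟨ζ, hall.recurrent hloop hconn hbdry hstab, fun u => ?_⟩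
  · rw [← hr ⟨w, hwW⟩]
    change η w - 1 < η w
    omega
  · by_cases huw : u = ⟨w, hwW⟩
    · subst huw
      simp [hζ, hwW]
    · have : (u : G.Interior) ≠ w := fun h => huw (Subtype.ext h)
      rw [Function.update_of_ne huw, ← hr u]
      simp [hζ, this]

omit hconn hbdry in
theorem isSpanningTree_burningMap_inter (h : G.IsTwoPhase W (G.phase₁ W η) (G.phase₂ W η))
    (hs : G.Stable η) (hX : G.allBurnt η (toVerts W)ᶜ G.bdry = (toVerts W)ᶜ) :
    (G.wiredOff W).IsSpanningTree (G.burningMap rank W η ∩ G.edgesAt W) := by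
  obtain ⟨f, hf, hφ, hsel⟩ := exists_parentMap_burningMap hloop hrank h hs
  rw [← hφ]
  refine hf.isSpanningTree_inter fun v hv => ?_
  obtain ⟨o, c, hoc⟩ := h.exists_stage v
  have h1 := hsel v o c hoc
  rcases hoc with hoc | hoc
  · exact Finset.disjoint_left.1 disjoint_fireEdges_edgesAt (mem_fireEdges.2 ⟨v, o, c, hoc, h1⟩)
  · refine absurd ?_ hoc.mem_of_burnt.2
    rw [hX]
    exact Finset.mem_compl.2 (mt coe_mem_toVerts.1 hv)

omit hconn hbdry in
-- An outside vertex ignited by `W` would select an edge at `W`, one more than a tree of `G_W`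
-- allows.
theorem allBurnt_eq_of_isSpanningTree (h : G.IsTwoPhase W (G.phase₁ W η) (G.phase₂ W η))
    (hs : G.Stable η)
    (hT : (G.wiredOff W).IsSpanningTree (G.burningMap rank W η ∩ G.edgesAt W)) :
    G.allBurnt η (toVerts W)ᶜ G.bdry = (toVerts W)ᶜ := by
  by_contra hX
  obtain ⟨f, hf, hφ, hsel⟩ := exists_parentMap_burningMap hloop hrank h hs
  rw [← hφ] at hT
  obtain ⟨v, k, x, hvW, -, hxW, -, hex⟩ := h.exists_ignited hsel hX
  exact hf.notMem_edgesAt hT v hvW ((mem_edgesAt_of_eq hex).2 (Or.inr hxW))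

omit hconn hbdry in
/-- The heights on `W` are determined by the selected edges at `W`. -/
theorem eq_on_of_burningMap_inter_eq (h : G.IsTwoPhase W (G.phase₁ W η) (G.phase₂ W η))
    (h' : G.IsTwoPhase W (G.phase₁ W η') (G.phase₂ W η')) (hs : G.Stable η) (hs' : G.Stable η')
    (hX : G.allBurnt η (toVerts W)ᶜ G.bdry = (toVerts W)ᶜ)
    (heq : G.burningMap rank W η' ∩ G.edgesAt W = G.burningMap rank W η ∩ G.edgesAt W)
    (w : G.Interior) (hw : w ∈ W) : η' w = η w := by
  have hX' := allBurnt_eq_of_isSpanningTree hloop hrank h' hs' (by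
    rw [heq]
    exact isSpanningTree_burningMap_inter hloop hrank h hs hX)
  -- The glued configuration has the first phase of `η'` and the second phase of `η`. It therefore
  -- selects the same edges as `η'`, and injectivity gives `ζ = η'`.
  set ζ : G.Interior → ℕ := fun v => if v ∈ W then η v else η' v with hζ
  have hζW : ∀ v : G.Interior, (v : V) ∈ Finset.univ → (v : V) ∉ (toVerts W)ᶜ → ζ v = η v :=
    fun v _ hv => if_pos (coe_mem_toVerts.1 (mem_toVerts_of_notMem_compl hv))
  have hζW' : ∀ v : G.Interior, (v : V) ∈ (toVerts W)ᶜ → (v : V) ∉ G.bdry → ζ v = η' v :=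
    fun v hv _ => if_neg fun h => Finset.mem_compl.1 hv (coe_mem_toVerts.2 h)
  have hsζ : G.Stable ζ := fun v => by
    simp only [hζ]
    split_ifs
    · exact hs v
    · exact hs' v
  have h₁ : G.phase₁ W ζ = G.phase₁ W η' := burnt_congr hζW'
  have hXζ : G.allBurnt ζ (toVerts W)ᶜ G.bdry = (toVerts W)ᶜ := by
    refine Eq.trans ?_ hX'
    ext v
    rw [mem_allBurnt, mem_allBurnt, burnt_congr hζW']
  have h₂ : G.phase₂ W ζ = G.phase₂ W η := by
    rw [phase₂, phase₂, hXζ, hX, burnt_congr hζW]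
  have hζ2 : G.IsTwoPhase W (G.phase₁ W ζ) (G.phase₂ W ζ) :=
    { zero₁ := rfl
      one₁ := rfl
      mono₁ := burnt_mono _ _ _
      zero₂ := rfl
      one₂ := fun v => mem_allBurnt
      mono₂ := burnt_mono _ _ _
      late := fun v hv _ => by
        change v ∈ G.allBurnt ζ (toVerts W)ᶜ G.bdry
        rw [hXζ]
        exact Finset.mem_compl.2 hv
      all := by rw [h₂]; exact h.all }
  have hφ : G.burningMap rank W ζ = G.burningMap rank W η' := by
    rw [burningMap_inter_edgesAt hX, burningMap_inter_edgesAt hX'] at heq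
    rw [burningMap, burningMap, hXζ, hX', fireEdges_congr hζW, fireEdges_congr hζW', heq]
  rw [← burningMap_injective hloop hrank hζ2 h' hsζ hs' hφ]
  exact if_pos hw

theorem sandpileProb_eq_div {ξ : W → ℕ} {T₀ : Finset E}
    (h : ∀ η, G.Recurrent η →
      (RestrictsTo η ξ ↔ G.burningMap rank W η ∩ G.edgesAt W = T₀)) :
    G.sandpileProb rank ξ = G.treeSumAt W T₀ / G.wired.treeSum := by
  classical
  have hbij := bijOn_burningMap hloop hrank hconn hbdry W
  rw [sandpileProb, ← Finset.sum_div, treeSumAt]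
  congr 1
  refine Finset.sum_bij (fun η _ => G.burningMap rank W η) ?_ ?_ ?_ ?_
  · intro η hη
    rw [Finset.mem_filter, mem_recurrentConfigs] at hη
    exact Finset.mem_filter.2 ⟨mem_spanningTrees.2 (hbij.mapsTo hη.1), (h η hη.1).1 hη.2⟩
  · intro η hη η' hη' heq
    rw [Finset.mem_filter, mem_recurrentConfigs] at hη hη'
    exact hbij.injOn hη.1 hη'.1 heq
  · intro A hA
    rw [Finset.mem_filter, mem_spanningTrees] at hA
    obtain ⟨η, hη, rfl⟩ := hbij.surjOn hA.1
    refine ⟨η, ?_, rfl⟩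
    rw [Finset.mem_filter, mem_recurrentConfigs]
    exact ⟨hη, (h η hη).2 hA.2⟩
  · intro η _
    rfl

end

end

end WeightedGraph

/-! ### The probability of a minimal subconfiguration. -/

theorem proposition4p3 {V E : Type*} [Fintype V] [Fintype E] [DecidableEq V] [DecidableEq E]
    (G : WeightedGraph V E)
    (hloop : ∀ e, G.src e ≠ G.tgt e)
    (hconn : G.IsConn)
    (hbdry : G.bdry.Nonempty)
    -- an ordering of the edges around each interior vertex
    (rank : G.Interior → E → ℕ)
    (hrank : ∀ v : G.Interior,
      Set.InjOn (rank v) (G.edgesTo (v : V) Finset.univ : Set E))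
    (W : Finset G.Interior)
    -- every vertex outside `W` is joined to the boundary by a path that avoids `W`
    (hW : ∀ v ∉ WeightedGraph.toVerts W, ∃ b ∈ G.bdry,
      ∃ p : (G.simple Finset.univ).Walk v b, ∀ x ∈ p.support, x ∉ WeightedGraph.toVerts W) :
    -- the burning map is a bijection from recurrent configurations to wired spanning trees
    Set.BijOn (G.burningMap rank W) {η | G.Recurrent η} {A | G.wired.IsSpanningTree A} ∧
    ∀ ξ : W → ℕ, G.IsMinimal ξ →
      ∃ T₀ : Finset E, (G.wiredOff W).IsSpanningTree T₀ ∧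
        (∀ η, G.Recurrent η → WeightedGraph.RestrictsTo η ξ →
          G.burningMap rank W η ∩ G.edgesAt W = T₀) ∧
        G.sandpileProb rank ξ = G.detCompl (G.edgesAt W \ T₀) ∧
        G.sandpileProb rank ξ =
          ∑ T ∈ (G.wiredOff W).spanningTrees,
            (G.wiredOff W).weight T₀ / (G.wiredOff W).treeSum *
              G.detCompl (G.edgesAt W \ T) := by
  have hbij := WeightedGraph.bijOn_burningMap hloop hrank hconn hbdry W
  refine ⟨hbij, fun ξ hξ => ?_⟩
  obtain ⟨η₀, hη₀, hr₀⟩ := hξ.1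
  have h2 : ∀ η, G.Recurrent η → G.IsTwoPhase W (G.phase₁ W η) (G.phase₂ W η) := fun η hη =>
    (hη.isAllowed hloop hconn hbdry).isTwoPhase W
  have hX : ∀ η, G.Recurrent η → WeightedGraph.RestrictsTo η ξ → _ := fun η hη hr =>
    hξ.allBurnt_eq hloop hconn hbdry hrank hW hη hr
  have hT₀ := WeightedGraph.isSpanningTree_burningMap_inter hloop hrank (h2 η₀ hη₀) hη₀.1
    (hX η₀ hη₀ hr₀)
  -- Any extension `η₀` of `ξ` may define `T₀`: with the first phase exhausting the outside of `W`,
  -- heights on `W` and selected edges at `W` determine each other.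
  have hiff : ∀ η, G.Recurrent η → (WeightedGraph.RestrictsTo η ξ ↔
      G.burningMap rank W η ∩ G.edgesAt W = G.burningMap rank W η₀ ∩ G.edgesAt W) := by
    refine fun η hη => ⟨fun hr => ?_, fun heq w => ?_⟩
    · rw [WeightedGraph.burningMap_inter_edgesAt (hX η hη hr),
        WeightedGraph.burningMap_inter_edgesAt (hX η₀ hη₀ hr₀)]
      refine WeightedGraph.fireEdges_congr fun v _ hv => ?_
      have hv := WeightedGraph.coe_mem_toVerts.1 (WeightedGraph.mem_toVerts_of_notMem_compl hv)
      exact (hr ⟨v, hv⟩).trans (hr₀ ⟨v, hv⟩).symm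
    · rw [← hr₀ w]
      exact WeightedGraph.eq_on_of_burningMap_inter_eq hloop hrank (h2 η₀ hη₀) (h2 η hη) hη₀.1
        hη.1 (hX η₀ hη₀ hr₀) heq w w.2
  have hZ : G.wired.treeSum ≠ 0 := (WeightedGraph.treeSum_pos (hbij.mapsTo hη₀)).ne'
  have hprob : G.sandpileProb rank ξ =
      G.detCompl (G.edgesAt W \ (G.burningMap rank W η₀ ∩ G.edgesAt W)) := by
    rw [WeightedGraph.sandpileProb_eq_div hloop hconn hbdry hrank hiff,
      ← WeightedGraph.detCompl_mul_treeSum_eq hloop hZ hT₀, mul_div_cancel_right₀ _ hZ]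
  refine ⟨_, hT₀, fun η hη hr => (hiff η hη).1 hr, hprob, ?_⟩
  rw [WeightedGraph.sum_weight_div_mul_detCompl hloop hZ hT₀]
  exact hprob
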